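/- **Setting.** Streams consist of updates $(i,\Delta)\in[n]\times\{-1,1\}$ to a vector $v\in\mathbb Z^n$ that is initially $0$; $m$ is an upper bound on the stream length. $Q'$ is a $(1\pm\beta)$-approximation to $Q$ if $(1-\beta)Q\le Q'\le(1+\beta)Q$. A streaming algorithm keeps a memory content between updates, initializes it, updates it and reports estimates from it using fresh random coins (reporting does not change the memory); it uses $S$ words of space, for a word length of $w$ bits, if its memory has at most $2^{wS}$ possible contents. In the $q$-query game an adaptive adversary chooses in each of $m$ rounds an update and whether to query the algorithm after it, depending on all previous updates and on all answers received so far, with at most $q$ queries in total. The algorithm is a $q$-query adversarially robust $(1\pm\alpha)$-approximation of $f$ with success probability $p$ if against every such adversary, with probability at least $p$, every answer is a $(1\pm\alpha)$-approximation of $f(v)$ at the time of the query. Let $\alpha,\delta\in(0,1)$, let $q\ge1$ be an integer and $\tau\ge1$. Let $f:\mathbb Z^n\to[0,\infty)$ take values in $\{0\}\cup[1,\tau]$ on all vectors produced by non-empty streams of at most $m$ updates. Let $\mathcal A$ be a streaming algorithm that uses $S$ words of space and that, on each fixed non-empty stream of at most $m$ updates, reports a $(1\pm\alpha/3)$-approximation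 of $f(v)$ with probability at least $9/10$ when queried once. **Algorithm.** Put $\varepsilon=1/100$, $\delta'=\varepsilon\delta/(10q)$, $\varepsilon'=\varepsilon/\sqrt{8q\ln(1/\delta')}$ and $k=\left\lceil C\,\varepsilon'^{-1}\log\frac{2q\log 2\tau}{\alpha\delta}\right\rceil$. Let $X$ consist of $0$ and the powers $(1+\alpha/3)^i\in[1,\tau]$, $i\ge0$. Run $k$ independent copies of $\mathcal A$ on the stream. At a query, take the current estimate of each copy, round it up to a power of $1+\alpha/3$ and truncate it to the range of the powers in $X$ (estimates that are at most $0$ become $0$), and output $M(\gamma'_1,\dots,\gamma'_k)$, with fresh randomness, where $\gamma'_1,\dots,\gamma'_k\in X$ are the results and $M:X^k\to X$ is a randomized mechanism that is an $(\varepsilon',0)$-differentially private median with failure probability $\frac{\delta}{2q}$ and error $\Gamma=c\,\varepsilon'^{-1}\log\frac{|X|}{\delta/(2q)}$: for all databases $D,D'\in X^k$ that differ in at most one row and all $T\subseteq X$, $\Pr[M(D)\in T]\le e^{\varepsilon'}\Pr[M(D')\in T]$, and for every $D\in X^k$, with probability at least $1-\frac{\delta}{2q}$, at least $k/2-\Gamma$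 rows of $D$ are $\ge M(D)$ and at least $k/2-\Gamma$ rows are $\le M(D)$. **Claim.** For every sufficiently large absolute constant $c$ and every $C$ that is sufficiently large depending only on $c$, there is a constant $K$ depending only on $c$ and $C$ such that for all parameters, $f$ and $\mathcal A$ as above: such a mechanism $M$ exists, and with every such $M$ the algorithm is a $q$-query adversarially robust $(1\pm\alpha)$-approximation of $f$ on streams of length at most $m$ with success probability $1-\delta$, and it uses at most $\chi\cdot S$ words of space, where $$\chi = K\,\sqrt{q\log(2q/\delta)}\;\log\frac{2q\log 2\tau}{\alpha\delta}.$$ -/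

import Mathlib

noncomputable section

namespace RobustStreaming

/-- `Q'` is a `(1 ± β)`-approximation to `Q`. -/
def IsApprox (β Q Q' : ℝ) : Prop := (1 - β) * Q ≤ Q' ∧ Q' ≤ (1 + β) * Q

/-- The probability of the event `E` under `p`. -/
def prob {Ω : Type*} (p : PMF Ω) (E : Set Ω) : ℝ := (p.toOuterMeasure E).toReal

/-- The joint law of `k` independent random variables with laws `p 0, …, p (k - 1)`. -/
def indep {Ω : Type} : (k : ℕ) → (Fin k → PMF Ω) → PMF (Fin k → Ω)
  | 0, _ => PMF.pure Fin.elim0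
  | k + 1, p => (p 0).bind fun a =>
      (indep k fun j => p j.succ).map fun t => (Fin.cons a t : Fin (k + 1) → Ω)

/-! ### Streaming algorithms -/

/-- An update `(i, Δ)` with `i ∈ [n]` and `Δ ∈ {-1, 1}`. -/
abbrev Update (n : ℕ) : Type := Fin n × ℤˣ

/-- The frequency vector produced by a stream of updates, starting from the zero vector. -/
def freq {n : ℕ} : List (Update n) → (Fin n → ℤ)
  | [] => 0
  | u :: us => freq us + Pi.single u.1 (u.2 : ℤ)

/-- A randomized streaming algorithm on frequency vectors of dimension `n`. A `State` is a content
of the whole memory that the algorithm keeps between two updates (stored random bits included).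
The algorithm flips fresh coins when it starts, when it processes an update, and when it reports an
estimate; reporting an estimate does not change the memory. -/
structure StreamAlg (n : ℕ) where
  State : Type
  init : PMF State
  step : State → Update n → PMF State
  out : State → PMF ℝ

namespace StreamAlg

variable {n : ℕ}

/-- `A` uses at most `S` words of `w` bits: its memory has at most `2 ^ (w S)` contents. -/
def UsesSpace (A : StreamAlg n) (w : ℕ) (S : ℝ) : Prop :=
  Finite A.State ∧ (Nat.card A.State : ℝ) ≤ (2 : ℝ) ^ ((w : ℝ) * S)

/-- The law of the memory after a fixed stream. Streams are listed with the newest update first. -/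
def run (A : StreamAlg n) : List (Update n) → PMF A.State
  | [] => A.init
  | u :: us => (A.run us).bind fun s => A.step s u

/-- The law of the estimate reported when `A` is queried (once) after a fixed stream. -/
def estimate (A : StreamAlg n) (us : List (Update n)) : PMF ℝ := (A.run us).bind A.out

/-- Oblivious correctness: on each fixed stream of at most `m` updates, `A` reports a
`(1 ± β)`-approximation of `f` with probability at least `p`. -/
def IsOblivious (A : StreamAlg n) (f : (Fin n → ℤ) → ℝ) (β : ℝ) (m : ℕ) (p : ℝ) : Prop :=
  ∀ us : List (Update n), us ≠ [] → us.length ≤ m →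
    p ≤ prob (A.estimate us) {y | IsApprox β (f (freq us)) y}

end StreamAlg

/-! ### The game against an adaptive adversary -/

/-- What the adversary has seen, newest round first: for each round the update that it sent, and
the output that it received if it made a query in that round. -/
abbrev History (n : ℕ) : Type := List (Update n × Option ℝ)

/-- The number of queries made so far. -/
def History.queries {n : ℕ} (h : History n) : ℕ := h.countP fun r => r.2.isSome

/-- A (possibly randomized) adversary: given the history it picks the next update and decides
whether it queries the algorithm after this update. -/
abbrev Adversary (n : ℕ) : Type := History n → PMF (Update n × Bool)

/-- The adversary makes at most `q` queries. -/
def Adversary.QueryBounded {n : ℕ} (adv : Adversary n) (q : ℕ) : Prop :=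
  ∀ h : History n, q ≤ h.queries → ∀ a ∈ (adv h).support, a.2 = false

/-- All queries in the history were answered by `(1 ± α)`-approximations of the value of `f` at the
frequency vector at the time of the query. -/
def AllCorrect {n : ℕ} (f : (Fin n → ℤ) → ℝ) (α : ℝ) : History n → Prop
  | [] => True
  | (_, none) :: h => AllCorrect f α h
  | (u, some y) :: h => IsApprox α (f (freq (u :: h.map Prod.fst))) y ∧ AllCorrect f α h

namespace StreamAlg

variable {n : ℕ}

/-- The joint law of the memory of the algorithm and the history after `j` rounds. -/
def play (B : StreamAlg n) (adv : Adversary n) : ℕ → PMF (B.State × History n)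
  | 0 => B.init.map fun s => (s, [])
  | j + 1 => (B.play adv j).bind fun x => (adv x.2).bind fun a => (B.step x.1 a.1).bind fun s =>
      if a.2 = true then (B.out s).map fun y => (s, (a.1, some y) :: x.2)
      else PMF.pure (s, (a.1, none) :: x.2)

/-- `B` is a `q`-query adversarially robust `(1 ± α)`-approximation algorithm for `f` on streams of
length `m`, with success probability at least `p`. -/
def IsRobust (B : StreamAlg n) (f : (Fin n → ℤ) → ℝ) (α : ℝ) (m q : ℕ) (p : ℝ) : Prop :=
  ∀ adv : Adversary n, adv.QueryBounded q → p ≤ prob (B.play adv m) {x | AllCorrect f α x.2}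

end StreamAlg

/-! ### Differentially private medians -/

/-- `(ε, δ)`-differential privacy of a randomized mechanism on databases with `k` rows. -/
def IsDP {k : ℕ} {X Y : Type*} (M : (Fin k → X) → PMF Y) (ε δ : ℝ) : Prop :=
  ∀ D D' : Fin k → X, (∃ i, ∀ j, j ≠ i → D j = D' j) →
    ∀ T : Set Y, prob (M D) T ≤ Real.exp ε * prob (M D') T + δ

/-- `M` is an `(ε, 0)`-DP median: with probability at least `1 - β` its output `x` is such that at
least `k / 2 - Γ` rows are at least `x` and at least `k / 2 - Γ` rows are at most `x`. -/
def IsDPMedian {k : ℕ} {X : Type*} [LinearOrder X] (M : (Fin k → X) → PMF X) (ε β Γ : ℝ) : Prop :=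
  IsDP M ε 0 ∧ ∀ D : Fin k → X, 1 - β ≤ prob (M D)
    {x | (k : ℝ) / 2 - Γ ≤ ((Finset.univ.filter fun i => x ≤ D i).card : ℝ) ∧
      (k : ℝ) / 2 - Γ ≤ ((Finset.univ.filter fun i => D i ≤ x).card : ℝ)}

/-! ### Rounding of the estimates -/

/-- The largest `i` with `(1 + α / 3) ^ i ≤ τ`. -/
def maxExp (α τ : ℝ) : ℕ := ⌊Real.logb (1 + α / 3) τ⌋₊

/-- The possible rounded estimates: `0` and the powers of `1 + α / 3` in `[1, τ]`. -/
def grid (α τ : ℝ) : Finset ℝ :=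
  insert 0 ((Finset.range (maxExp α τ + 1)).image fun i => (1 + α / 3) ^ i)

/-- A positive estimate is rounded up to a power of `1 + α / 3`, and then truncated to the range of
the powers that lie in `[1, τ]`. Nonpositive estimates become `0`. -/
def roundVal (α τ y : ℝ) : ℝ :=
  if y ≤ 0 then 0 else (1 + α / 3) ^ min ⌈Real.logb (1 + α / 3) y⌉₊ (maxExp α τ)

theorem roundVal_mem (α τ y : ℝ) : roundVal α τ y ∈ grid α τ := by
  unfold roundVal grid
  split_ifs
  · exact Finset.mem_insert_self _ _
  · exact Finset.mem_insert_of_mem (Finset.mem_image_of_mem _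
      (Finset.mem_range.2 (Nat.lt_succ_of_le (min_le_right _ _))))

/-- The rounded estimate as an element of the finite set `grid α τ`. -/
def roundGrid (α τ y : ℝ) : grid α τ := ⟨roundVal α τ y, roundVal_mem α τ y⟩

/-! ### The bounded query algorithm -/

/-- The privacy parameter `ε = 1 / 100` of the whole algorithm. -/
def epsTotal : ℝ := 1 / 100

/-- `δ' = ε δ / (10 q)`. -/
def deltaPrime (q : ℕ) (δ : ℝ) : ℝ := epsTotal * δ / (10 * q)

/-- `ε' = ε / √(8 q ln (1 / δ'))`, the privacy parameter of one median computation. -/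
def epsPrime (q : ℕ) (δ : ℝ) : ℝ :=
  epsTotal / Real.sqrt (8 * q * Real.log (1 / deltaPrime q δ))

/-- The number `k = ⌈C ε'⁻¹ log (2 q log (2 τ) / (α δ))⌉` of copies; `C` is the constant of the
`Θ`-notation. -/
def numCopies (C : ℝ) (q : ℕ) (α δ τ : ℝ) : ℕ :=
  ⌈C * (epsPrime q δ)⁻¹ * Real.log (2 * q * Real.log (2 * τ) / (α * δ))⌉₊

/-- The error `Γ = c ε'⁻¹ log (|X| / β)` of the median computation, where `X` is the set of possible
rounded estimates and `β = δ / (2 q)`; `c` is the constant of the `O`-notation. -/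
def medianError (c : ℝ) (q : ℕ) (α δ τ : ℝ) : ℝ :=
  c * (epsPrime q δ)⁻¹ * Real.log (((grid α τ).card : ℝ) / (δ / (2 * q)))

/-- The bounded query algorithm: it runs `k` independent copies of `A`, passes every update to all
of them, and answers a query by applying the private median mechanism `M` to the rounded estimates
of the copies. -/
def boundedQueryAlg {n : ℕ} (A : StreamAlg n) (α τ : ℝ) (k : ℕ)
    (M : (Fin k → grid α τ) → PMF (grid α τ)) : StreamAlg n where
  State := Fin k → A.State
  init := indep k fun _ => A.init
  step s u := indep k fun j => A.step (s j) u
  out s := ((indep k fun j => (A.out (s j)).map (roundGrid α τ)).bind M).map Subtype.val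

end RobustStreaming

end

open RobustStreaming

/-!
Presample all the coins of each copy, so that a copy becomes a fixed random table that lists its
rounded estimate after every possible stream. The adversary then learns about the tables only
through the answers, and each answer is a differentially private function of them.

Fix a set `J` of `s ≈ log (q / δ)` copies. Replacing the tables in `J` by independent fresh ones
multiplies the probability of each transcript by a likelihood ratio, and privacy bounds the second
moment of this ratio by `exp ((s ε') ^ 2) ^ q`. By Cauchy–Schwarz, an event about the tables in `J`
and the transcript is therefore at most the square root of this bound times its probability for
fresh tables. For fresh tables, the probability that every copy in `J` is wrong at a given answer
is at most `10 ^ (-s)`, since the stream in question no longer depends on them.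

If nearly half of the copies are wrong at some answer, then a constant fraction to the power `s` of
all the sets `J` consists of wrong copies, so counting the sets `J` bounds the probability of this
event. Otherwise the answer of the median mechanism lies between two correct estimates.
-/

noncomputable section

namespace RobustStreaming

open scoped ENNReal

section Probability

variable {α β γ : Type*}

theorem hasSum_toReal (p : PMF α) : HasSum (fun a => (p a).toReal) 1 := by
  have h := ENNReal.hasSum_toReal p.tsum_coe_ne_top
  rwa [← ENNReal.tsum_toReal_eq p.apply_ne_top, p.tsum_coe, ENNReal.toReal_one] at h

theorem toOuterMeasure_ne_top (p : PMF α) (E : Set α) : p.toOuterMeasure E ≠ ∞ := by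
  rw [PMF.toOuterMeasure_apply]
  exact ne_top_of_le_ne_top p.tsum_coe_ne_top
    (ENNReal.tsum_le_tsum fun a => Set.indicator_le_self E p a)

theorem hasSum_prob (p : PMF α) (E : Set α) :
    HasSum (E.indicator fun a => (p a).toReal) (prob p E) := by
  have h_ne_top := toOuterMeasure_ne_top p E
  rw [PMF.toOuterMeasure_apply] at h_ne_top
  have h := ENNReal.hasSum_toReal h_ne_top
  rw [← ENNReal.tsum_toReal_eq (ENNReal.ne_top_of_tsum_ne_top h_ne_top),
    ← PMF.toOuterMeasure_apply] at h
  exact (Set.indicator_comp_of_zero (f := p) (g := ENNReal.toReal) ENNReal.toReal_zero) ▸ h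

theorem hasSum_prob_bind (p : PMF α) (f : α → PMF β) (E : Set β) :
    HasSum (fun a => (p a).toReal * prob (f a) E) (prob (p.bind f) E) := by
  have h_ne_top := toOuterMeasure_ne_top (p.bind f) E
  rw [PMF.toOuterMeasure_bind_apply] at h_ne_top
  have h := ENNReal.hasSum_toReal h_ne_top
  rw [← ENNReal.tsum_toReal_eq (ENNReal.ne_top_of_tsum_ne_top h_ne_top),
    ← PMF.toOuterMeasure_bind_apply] at h
  simpa only [prob, ENNReal.toReal_mul] using h

theorem prob_nonneg (p : PMF α) (E : Set α) : 0 ≤ prob p E := ENNReal.toReal_nonneg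

theorem prob_le_one (p : PMF α) (E : Set α) : prob p E ≤ 1 :=
  hasSum_le (Set.indicator_le_self' fun _ _ => ENNReal.toReal_nonneg) (hasSum_prob p E)
    (hasSum_toReal p)

theorem prob_mono_support (p : PMF α) {E F : Set α} (h : ∀ x ∈ p.support, x ∈ E → x ∈ F) :
    prob p E ≤ prob p F :=
  ENNReal.toReal_mono (toOuterMeasure_ne_top p F)
    (p.toOuterMeasure_mono fun x hx => h x hx.2 hx.1)

theorem prob_mono (p : PMF α) {E F : Set α} (h : E ⊆ F) : prob p E ≤ prob p F :=
  prob_mono_support p fun _ _ hx => h hx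

theorem prob_union_le (p : PMF α) (E F : Set α) : prob p (E ∪ F) ≤ prob p E + prob p F := by
  unfold prob
  rw [← ENNReal.toReal_add (toOuterMeasure_ne_top p E) (toOuterMeasure_ne_top p F)]
  exact ENNReal.toReal_mono
    (ENNReal.add_ne_top.2 ⟨toOuterMeasure_ne_top p E, toOuterMeasure_ne_top p F⟩)
    (MeasureTheory.measure_union_le E F)

theorem prob_compl (p : PMF α) (E : Set α) : prob p Eᶜ = 1 - prob p E := by
  have h := (hasSum_prob p E).add (hasSum_prob p Eᶜ)
  simp only [Set.indicator_self_add_compl_apply] at h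
  exact eq_sub_of_add_eq' (h.unique (hasSum_toReal p))

theorem prob_pure_of_mem {a : α} {E : Set α} (h : a ∈ E) : prob (PMF.pure a) E = 1 := by
  classical
  rw [prob, PMF.toOuterMeasure_pure_apply, if_pos h, ENNReal.toReal_one]

theorem prob_pure_of_notMem {a : α} {E : Set α} (h : a ∉ E) : prob (PMF.pure a) E = 0 := by
  classical
  rw [prob, PMF.toOuterMeasure_pure_apply, if_neg h, ENNReal.toReal_zero]

theorem prob_map (p : PMF α) (g : α → β) (E : Set β) : prob (p.map g) E = prob p (g ⁻¹' E) := by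
  rw [prob, prob, PMF.toOuterMeasure_map_apply]

theorem prob_bind_le_affine (p : PMF α) (f : α → PMF β) (g : α → PMF γ) (E : Set β) (F : Set γ)
    {A B : ℝ} (h : ∀ a ∈ p.support, prob (f a) E ≤ A + B * prob (g a) F) :
    prob (p.bind f) E ≤ A + B * prob (p.bind g) F := by
  have h_sum := ((hasSum_toReal p).mul_left A).add ((hasSum_prob_bind p g F).mul_left B)
  rw [mul_one] at h_sum
  refine hasSum_le (fun a => ?_) (hasSum_prob_bind p f E) h_sum
  by_cases ha : a ∈ p.support
  · calc (p a).toReal * prob (f a) E ≤ (p a).toReal * (A + B * prob (g a) F) :=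
          mul_le_mul_of_nonneg_left (h a ha) ENNReal.toReal_nonneg
      _ = A * (p a).toReal + B * ((p a).toReal * prob (g a) F) := by ring
  · simp [(p.apply_eq_zero_iff a).2 ha]

theorem prob_bind_le (p : PMF α) (f : α → PMF β) (E : Set β) {A : ℝ}
    (h : ∀ a ∈ p.support, prob (f a) E ≤ A) : prob (p.bind f) E ≤ A := by
  simpa using prob_bind_le_affine p f f E E (B := 0) (by simpa using h)

theorem bind_congr_of_mem_support {p : PMF α} {f g : α → PMF β}
    (h : ∀ a ∈ p.support, f a = g a) : p.bind f = p.bind g := by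
  ext b
  simp only [PMF.bind_apply]
  refine tsum_congr fun a => ?_
  by_cases ha : a ∈ p.support
  · rw [h a ha]
  · simp [(p.apply_eq_zero_iff a).2 ha]

theorem prob_exists_mem_list_le (p : PMF α) (P : α → β → Prop) {x : ℝ} :
    ∀ l : List β, (∀ b ∈ l, prob p {a | P a b} ≤ x) → prob p {a | ∃ b ∈ l, P a b} ≤ l.length * x
  | [], _ => by simp [prob]
  | b :: l, h => by
    have h_split : {a | ∃ c ∈ b :: l, P a c} = {a | P a b} ∪ {a | ∃ c ∈ l, P a c} := by
      ext a
      simp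
    have h_tail := prob_exists_mem_list_le p P l fun c hc => h c (List.mem_cons_of_mem b hc)
    calc prob p {a | ∃ c ∈ b :: l, P a c}
        ≤ prob p {a | P a b} + prob p {a | ∃ c ∈ l, P a c} := h_split ▸ prob_union_le p _ _
      _ ≤ x + l.length * x := add_le_add (h b List.mem_cons_self) h_tail
      _ = (b :: l).length * x := by rw [List.length_cons]; push_cast; ring

theorem mul_prob_le_sum {ι : Type*} (p : PMF α) (F : Set α) (S : Finset ι) (E : ι → Set α)
    (c : ℝ) (h : ∀ x ∈ F, ∃ T ⊆ S, c ≤ T.card ∧ ∀ J ∈ T, x ∈ E J) :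
    c * prob p F ≤ ∑ J ∈ S, prob p (E J) := by
  refine hasSum_le (fun x => ?_) ((hasSum_prob p F).mul_left c)
    (hasSum_sum fun J _ => hasSum_prob p (E J))
  have h_nonneg : ∀ J, 0 ≤ (E J).indicator (fun a => (p a).toReal) x :=
    fun J => Set.indicator_nonneg (fun _ _ => ENNReal.toReal_nonneg) x
  by_cases hx : x ∈ F
  · obtain ⟨T, hTS, hc, hT⟩ := h x hx
    calc c * F.indicator (fun a => (p a).toReal) x ≤ T.card * (p x).toReal := by
          rw [Set.indicator_of_mem hx]
          exact mul_le_mul_of_nonneg_right hc ENNReal.toReal_nonneg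
      _ = ∑ J ∈ T, (E J).indicator (fun a => (p a).toReal) x := by
          rw [← nsmul_eq_mul, ← Finset.sum_const]
          refine Finset.sum_congr rfl fun J hJ => ?_
          rw [Set.indicator_of_mem (hT J hJ)]
      _ ≤ ∑ J ∈ S, (E J).indicator (fun a => (p a).toReal) x :=
          Finset.sum_le_sum_of_subset_of_nonneg hTS fun J _ _ => h_nonneg J
  · rw [Set.indicator_of_notMem hx, mul_zero]
    exact Finset.sum_nonneg fun J _ => h_nonneg J

theorem choose_mul_prob_exists_card_le {ι : Type*} [Fintype ι] (p : PMF α)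
    (S : α → Finset ι → Prop) (hS : ∀ a, Antitone (S a)) {s b : ℕ} {y : ℝ}
    (h : ∀ J : Finset ι, J.card = s → prob p {a | S a J} ≤ y) :
    b.choose s * prob p {a | ∃ B, b ≤ B.card ∧ S a B} ≤ (Fintype.card ι).choose s * y := by
  calc b.choose s * prob p {a | ∃ B, b ≤ B.card ∧ S a B}
      ≤ ∑ J ∈ Finset.univ.powersetCard s, prob p {a | S a J} := by
        refine mul_prob_le_sum p _ _ _ _ fun a ⟨B, hB, ha⟩ => ⟨B.powersetCard s,
          Finset.powersetCard_mono B.subset_univ, ?_,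
          fun J hJ => hS a (Finset.mem_powersetCard.1 hJ).1 ha⟩
        rw [Finset.card_powersetCard]
        exact_mod_cast Nat.choose_le_choose s hB
    _ ≤ ∑ _J ∈ (Finset.univ : Finset ι).powersetCard s, y :=
        Finset.sum_le_sum fun J hJ => h J (Finset.mem_powersetCard.1 hJ).2
    _ = (Fintype.card ι).choose s * y := by
        rw [Finset.sum_const, Finset.card_powersetCard, nsmul_eq_mul, Finset.card_univ]

end Probability

section Indistinguishability

variable {k : ℕ} {X Y Y' β γ : Type*} {η : ℝ}

/-- The laws `p` and `p'` are within a factor `exp η` of each other on every event. This is the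
relation between the outputs of a pure differentially private mechanism on similar databases, in a
form that survives post-processing. -/
def Indistinguishable (η : ℝ) (p p' : PMF Y) : Prop :=
  ∀ T : Set Y, prob p T ≤ Real.exp η * prob p' T ∧ prob p' T ≤ Real.exp η * prob p T

theorem Indistinguishable.refl (p : PMF Y) : Indistinguishable 0 p p := fun T => by simp

theorem Indistinguishable.map {p p' : PMF Y} (h : Indistinguishable η p p') (g : Y → Y') :
    Indistinguishable η (p.map g) (p'.map g) := fun T => by
  simpa only [prob_map] using h (g ⁻¹' T)

theorem Indistinguishable.apply_toReal_le {p p' : PMF Y} (h : Indistinguishable η p p') (y : Y) :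
    (p y).toReal ≤ Real.exp η * (p' y).toReal ∧ (p' y).toReal ≤ Real.exp η * (p y).toReal := by
  simpa only [prob, PMF.toOuterMeasure_apply_singleton] using h {y}

theorem IsDP.prob_le_of_eqOn_compl {M : (Fin k → X) → PMF Y} {ε : ℝ} (hM : IsDP M ε 0)
    (T : Set Y) (J : Finset (Fin k)) : ∀ D D' : Fin k → X, (∀ i ∉ J, D i = D' i) →
      prob (M D) T ≤ Real.exp (J.card * ε) * prob (M D') T := by
  classical
  induction J using Finset.induction_on with
  | empty =>
    intro D D' h
    rw [funext fun i => h i (Finset.notMem_empty i)]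
    simp
  | insert a J ha ih =>
    intro D D' h
    have h_update : ∀ i ∉ J, D i = Function.update D' a (D a) i := fun i hi => by
      by_cases hia : i = a
      · rw [hia, Function.update_self]
      · rw [Function.update_of_ne hia, h i (by simp [hia, hi])]
    have h_row := hM (Function.update D' a (D a)) D'
      ⟨a, fun j hj => Function.update_of_ne hj _ _⟩ T
    rw [add_zero] at h_row
    calc prob (M D) T ≤ Real.exp (J.card * ε) * prob (M (Function.update D' a (D a))) T :=
          ih _ _ h_update
      _ ≤ Real.exp (J.card * ε) * (Real.exp ε * prob (M D') T) := by gcongr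
      _ = Real.exp ((insert a J).card * ε) * prob (M D') T := by
          rw [Finset.card_insert_of_notMem ha, ← mul_assoc, ← Real.exp_add]
          push_cast
          ring_nf

theorem IsDP.indistinguishable {M : (Fin k → X) → PMF Y} {ε : ℝ} (hM : IsDP M ε 0)
    {J : Finset (Fin k)} {D D' : Fin k → X} (h : ∀ i ∉ J, D i = D' i) :
    Indistinguishable (J.card * ε) (M D) (M D') := fun T =>
  ⟨hM.prob_le_of_eqOn_compl T J D D' h,
    hM.prob_le_of_eqOn_compl T J D' D fun i hi => (h i hi).symm⟩

theorem exp_add_exp_neg_sub_one_le (x : ℝ) :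
    Real.exp x + Real.exp (-x) - 1 ≤ Real.exp (x ^ 2) := by
  have h_cosh := Real.cosh_le_exp_half_sq x
  rw [Real.cosh_eq] at h_cosh
  have h_sq : Real.exp (x ^ 2) = Real.exp (x ^ 2 / 2) ^ 2 := by
    rw [← Real.exp_nat_mul]
    push_cast
    ring_nf
  nlinarith [sq_nonneg (Real.exp (x ^ 2 / 2) - 1)]

-- The bound `a² / b ≤ (exp η + exp (-η)) a - b`, which is `(a - exp (-η) b) (exp η b - a) ≥ 0`,
-- combined with `2 l a x ≤ l² a² / b + b x²`.
theorem two_mul_mul_le_of_le_exp_mul {a b : ℝ} (ha : 0 ≤ a) (hb : 0 ≤ b)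
    (hab : a ≤ Real.exp η * b) (hba : b ≤ Real.exp η * a) (l x : ℝ) :
    2 * l * (a * x) ≤ l ^ 2 * ((Real.exp η + Real.exp (-η)) * a - b) + b * x ^ 2 := by
  rcases hb.eq_or_lt with rfl | hb
  · have : a = 0 := le_antisymm (by simpa using hab) ha
    simp [this]
  have h_exp : Real.exp η * Real.exp (-η) = 1 := by
    rw [← Real.exp_add, add_neg_cancel, Real.exp_zero]
  have hba' : Real.exp (-η) * b ≤ a := by
    rwa [Real.exp_neg, inv_mul_le_iff₀ (Real.exp_pos _)]
  have h_sq : a ^ 2 ≤ b * ((Real.exp η + Real.exp (-η)) * a - b) := by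
    have := mul_nonneg (sub_nonneg.2 hba') (sub_nonneg.2 hab)
    linear_combination this - b ^ 2 * h_exp
  refine le_of_mul_le_mul_left ?_ hb
  linear_combination l ^ 2 * h_sq + sq_nonneg (l * a - b * x)

theorem Indistinguishable.sq_prob_bind_le {p p' : PMF Y} (h : Indistinguishable η p p')
    (f : Y → PMF β) (f' : Y → PMF γ) (E : Set β) (F : Set γ) {Z : ℝ}
    (hZ : ∀ y ∈ p.support, prob (f y) E ^ 2 ≤ Z * prob (f' y) F) :
    prob (p.bind f) E ^ 2 ≤ Real.exp (η ^ 2) * Z * prob (p'.bind f') F := by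
  set V := Real.exp (η ^ 2)
  set l := prob (p.bind f) E / V
  have hV : 0 < V := Real.exp_pos _
  have h_term : ∀ y, 2 * l * ((p y).toReal * prob (f y) E) ≤
      l ^ 2 * ((Real.exp η + Real.exp (-η)) * (p y).toReal - (p' y).toReal)
        + Z * ((p' y).toReal * prob (f' y) F) := fun y => by
    obtain ⟨hab, hba⟩ := h.apply_toReal_le y
    by_cases hy : y ∈ p.support
    · linear_combination two_mul_mul_le_of_le_exp_mul ENNReal.toReal_nonneg ENNReal.toReal_nonneg
        hab hba l (prob (f y) E) + (p' y).toReal * hZ y hy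
    · have ha : (p y).toReal = 0 := by simp [(p.apply_eq_zero_iff y).2 hy]
      have hb : (p' y).toReal = 0 := le_antisymm (by simpa [ha] using hba) ENNReal.toReal_nonneg
      simp [ha, hb]
  have h_sum := hasSum_le h_term ((hasSum_prob_bind p f E).mul_left (2 * l))
    (((((hasSum_toReal p).mul_left _).sub (hasSum_toReal p')).mul_left (l ^ 2)).add
      ((hasSum_prob_bind p' f' F).mul_left Z))
  have h_moment : l ^ 2 * ((Real.exp η + Real.exp (-η)) * 1 - 1) ≤ l ^ 2 * V := by
    rw [mul_one]
    exact mul_le_mul_of_nonneg_left (exp_add_exp_neg_sub_one_le η) (sq_nonneg l)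
  have hl : prob (p.bind f) E = l * V := (div_mul_cancel₀ _ hV.ne').symm
  rw [hl] at h_sum ⊢
  have h_le : l ^ 2 * V ≤ Z * prob (p'.bind f') F := by linear_combination h_sum + h_moment
  linear_combination V * h_le

theorem sq_prob_bind_le (p : PMF Y) (f : Y → PMF β) (f' : Y → PMF γ) (E : Set β) (F : Set γ)
    {Z : ℝ} (hZ : ∀ y ∈ p.support, prob (f y) E ^ 2 ≤ Z * prob (f' y) F) :
    prob (p.bind f) E ^ 2 ≤ Z * prob (p.bind f') F := by
  simpa using (Indistinguishable.refl p).sq_prob_bind_le f f' E F hZ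

end Indistinguishability

section Independence

variable {Ω Ω' ι : Type} {H : Type*}

theorem indep_pure : ∀ (k : ℕ) (a : Fin k → Ω), (indep k fun j => PMF.pure (a j)) = PMF.pure a
  | 0, a => congrArg PMF.pure (Subsingleton.elim _ _)
  | k + 1, a => by
    rw [indep, PMF.pure_bind, indep_pure k, PMF.pure_map]
    exact congrArg PMF.pure (Fin.cons_self_tail a)

theorem indep_bind : ∀ (k : ℕ) (p : Fin k → PMF Ω) (f : Fin k → Ω → PMF Ω'),
    (indep k fun j => (p j).bind (f j)) = (indep k p).bind fun t => indep k fun j => f j (t j)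
  | 0, p, f => by simp only [indep, PMF.pure_bind]
  | k + 1, p, f => by
    simp only [indep, PMF.bind_bind, indep_bind k (fun j => p j.succ), PMF.map_bind,
      PMF.bind_map, Function.comp_def, Fin.cons_zero, Fin.cons_succ]
    refine congrArg (PMF.bind (p 0)) (funext fun a => ?_)
    rw [PMF.bind_comm]

theorem indep_map (k : ℕ) (p : Fin k → PMF Ω) (f : Fin k → Ω → Ω') :
    (indep k fun j => (p j).map (f j)) = (indep k p).map fun t j => f j (t j) := by
  have h := indep_bind k p fun j a => PMF.pure (f j a)
  simp only [indep_pure] at h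
  exact h

theorem map_eval_indep : ∀ (k : ℕ) (p : Fin k → PMF Ω) (i : Fin k),
    (indep k p).map (fun t => t i) = p i
  | k + 1, p, i => by
    rw [indep, PMF.map_bind]
    simp only [PMF.map_comp]
    refine Fin.cases ?_ (fun j => ?_) i
    · simp only [Function.comp_def, Fin.cons_zero]
      conv_rhs => rw [← (p 0).bind_pure]
      exact congrArg (PMF.bind (p 0)) (funext fun a => PMF.map_const _ _)
    · simp only [Function.comp_def, Fin.cons_succ, map_eval_indep k (fun j => p j.succ) j,
        PMF.bind_const]

theorem mem_support_of_mem_support_indep {k : ℕ} {p : Fin k → PMF Ω} {t : Fin k → Ω}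
    (ht : t ∈ (indep k p).support) (i : Fin k) : t i ∈ (p i).support := by
  rw [← map_eval_indep k p i]
  exact (PMF.mem_support_map_iff _ _ _).2 ⟨t, ht, rfl⟩

theorem prob_indep_pi : ∀ (k : ℕ) (p : Fin k → PMF Ω) (B : Fin k → Set Ω),
    prob (indep k p) {t | ∀ i, t i ∈ B i} = ∏ i, prob (p i) (B i)
  | 0, p, B => by
    rw [Fin.prod_univ_zero]
    exact prob_pure_of_mem fun i => i.elim0
  | k + 1, p, B => by
    have h_cons : ∀ a, (p 0 a).toReal * prob ((indep k fun j => p j.succ).map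
          fun t => (Fin.cons a t : Fin (k + 1) → Ω)) {t | ∀ i, t i ∈ B i}
        = (B 0).indicator (fun a => (p 0 a).toReal) a
          * ∏ i : Fin k, prob (p i.succ) (B i.succ) := by
      intro a
      rw [← prob_indep_pi k (fun j => p j.succ) fun j => B j.succ, prob_map]
      by_cases ha : a ∈ B 0
      · simp [Fin.forall_fin_succ, ha]
      · simp [Fin.forall_fin_succ, ha, prob]
    rw [Fin.prod_univ_succ]
    refine (hasSum_prob_bind (p 0) _ _).unique ?_
    simp only [h_cons]
    exact (hasSum_prob (p 0) (B 0)).mul_right _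

theorem prob_indep_forall_mem (k : ℕ) (p : Fin k → PMF Ω) (J : Finset (Fin k))
    (B : Fin k → Set Ω) {x : ℝ} (h : ∀ i ∈ J, prob (p i) (B i) ≤ x) :
    prob (indep k p) {t | ∀ i ∈ J, t i ∈ B i} ≤ x ^ J.card := by
  classical
  have h_univ : ∀ i, prob (p i) Set.univ = 1 := fun i => by
    simpa [prob] using prob_compl (p i) ∅
  have h_pi : {t : Fin k → Ω | ∀ i ∈ J, t i ∈ B i}
      = {t | ∀ i, t i ∈ if i ∈ J then B i else Set.univ} := by
    ext t
    refine forall_congr' fun i => ?_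
    split_ifs with hi <;> simp [hi]
  rw [h_pi, prob_indep_pi]
  calc ∏ i, prob (p i) (if i ∈ J then B i else Set.univ)
      = ∏ i, if i ∈ J then prob (p i) (B i) else 1 :=
        Finset.prod_congr rfl fun i _ => by split_ifs <;> simp [h_univ]
    _ = ∏ i ∈ J, prob (p i) (B i) := by rw [Finset.prod_ite_mem, Finset.univ_inter]
    _ ≤ ∏ _i ∈ J, x := Finset.prod_le_prod (fun i _ => prob_nonneg _ _) h
    _ = x ^ J.card := Finset.prod_const x

/-- The joint law of a family of independent random variables over a finite index type; it extends
`indep` to index types that come without an enumeration. -/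
def indepFamily [Fintype ι] (p : ι → PMF Ω) : PMF (ι → Ω) :=
  (indep (Fintype.card ι) fun j => p ((Fintype.equivFin ι).symm j)).map fun t i =>
    t (Fintype.equivFin ι i)

theorem map_eval_indepFamily [Fintype ι] (p : ι → PMF Ω) (i : ι) :
    (indepFamily p).map (fun t => t i) = p i := by
  have h := map_eval_indep _ (fun j => p ((Fintype.equivFin ι).symm j)) (Fintype.equivFin ι i)
  rw [Equiv.symm_apply_apply] at h
  rw [indepFamily, PMF.map_comp]
  exact h

-- Independent pairs are invariant under the swap of the two components of any of the pairs.
theorem indep_bind_bind_piecewise {k : ℕ} (p : Fin k → PMF Ω) (J : Finset (Fin k))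
    (F : (Fin k → Ω) → (Fin k → Ω) → PMF H) :
    ((indep k p).bind fun T => (indep k p).bind fun T' =>
        F (J.piecewise T' T) (J.piecewise T T')) =
      (indep k p).bind fun T => (indep k p).bind fun T' => F T T' := by
  have h_pairs : ∀ G : (Fin k → Ω × Ω) → PMF H,
      ((indep k fun i => (p i).bind fun a => (p i).map (Prod.mk a)).bind G) =
        (indep k p).bind fun T => (indep k p).bind fun T' => G fun i => (T i, T' i) := fun G => by
    simp only [indep_bind, indep_map, PMF.bind_bind, PMF.bind_map, Function.comp_def]
  have h_swap : ∀ i, ((p i).bind fun a => (p i).map (Prod.mk a)).map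
      (fun x => if i ∈ J then x.swap else x) = (p i).bind fun a => (p i).map (Prod.mk a) :=
    fun i => by
      split_ifs
      · simp only [PMF.map, PMF.bind_bind, PMF.pure_bind, Function.comp_def, Prod.swap_prod_mk]
        exact PMF.bind_comm _ _ _
      · exact PMF.map_id _
  have h_indep := indep_map k (fun i => (p i).bind fun a => (p i).map (Prod.mk a))
    fun i x => if i ∈ J then x.swap else x
  simp only [h_swap] at h_indep
  have h_eq := congrArg (PMF.bind · fun t => F (fun i => (t i).1) fun i => (t i).2) h_indep
  simp only [PMF.bind_map, h_pairs, Function.comp_def] at h_eq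
  rw [h_eq]
  congr! 5 with T T'
  · ext i
    by_cases hi : i ∈ J <;> simp [hi]
  · ext i
    by_cases hi : i ∈ J <;> simp [hi]

theorem sq_prob_le_of_resample {k : ℕ} (p : Fin k → PMF Ω) (G : (Fin k → Ω) → PMF H)
    (J : Finset (Fin k)) (E : (Fin k → Ω) → Set H) {Z r : ℝ} (hZ : 0 ≤ Z)
    (hG : ∀ T T' : Fin k → Ω, (∀ i ∉ J, T i = T' i) →
      ∀ F, prob (G T) F ^ 2 ≤ Z * prob (G T') F)
    (hr : ∀ T, ∀ h ∈ (G T).support, prob (indep k p) {T' | h ∈ E (J.piecewise T' T)} ≤ r) :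
    prob ((indep k p).bind fun T => (G T).map (Prod.mk T)) {x | x.2 ∈ E x.1} ^ 2 ≤ Z * r := by
  have h_exchange : ((indep k p).bind fun T => (G T).map (Prod.mk T)) =
      (indep k p).bind fun T => (indep k p).bind fun T' =>
        (G (J.piecewise T' T)).map (Prod.mk (J.piecewise T' T)) := by
    rw [indep_bind_bind_piecewise p J fun T _ => (G T).map (Prod.mk T)]
    simp only [PMF.bind_const]
  have h_old : prob ((indep k p).bind fun T => (indep k p).bind fun T' =>
      (G T).map (Prod.mk (J.piecewise T' T))) {x | x.2 ∈ E x.1} ≤ r := by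
    refine prob_bind_le _ _ _ fun T _ => ?_
    simp only [PMF.map, PMF.bind_comm (indep k p)]
    refine prob_bind_le _ _ _ fun h hh => ?_
    change prob ((indep k p).map fun T' => (J.piecewise T' T, h)) _ ≤ r
    rw [prob_map]
    exact hr T h hh
  rw [h_exchange]
  refine (sq_prob_bind_le _ _ (fun T => (indep k p).bind fun T' =>
    (G T).map (Prod.mk (J.piecewise T' T))) _ _ fun T _ => ?_).trans
      (mul_le_mul_of_nonneg_left h_old hZ)
  refine sq_prob_bind_le _ _ _ _ _ fun T' _ => ?_
  simp only [prob_map]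
  exact hG _ _ (fun i hi => Finset.piecewise_eq_of_notMem _ _ _ hi) _

end Independence

section Game

variable {n : ℕ} {adv : Adversary n} {q : ℕ}

/-- The answers that were given in the game, each with the stream (newest update first) on which
the algorithm was queried. -/
def History.answers : History n → List (List (Update n) × ℝ)
  | [] => []
  | (_, none) :: h => answers h
  | (u, some y) :: h => (u :: h.map Prod.fst, y) :: answers h

theorem History.queries_cons_some (h : History n) (u : Update n) (y : ℝ) :
    History.queries ((u, some y) :: h) = h.queries + 1 :=
  List.countP_cons_of_pos rfl

theorem History.queries_cons_none (h : History n) (u : Update n) :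
    History.queries ((u, none) :: h) = h.queries :=
  List.countP_cons_of_neg Bool.false_ne_true

theorem History.length_answers : ∀ h : History n, h.answers.length = h.queries
  | [] => rfl
  | (u, none) :: h => by rw [queries_cons_none]; exact length_answers h
  | (u, some y) :: h => by
    rw [queries_cons_some, ← length_answers h]
    rfl

theorem History.stream_of_mem_answers : ∀ (h : History n), ∀ x ∈ h.answers,
    x.1 ≠ [] ∧ x.1.length ≤ h.length
  | [], _, hx => absurd hx List.not_mem_nil
  | (_, none) :: h, x, hx =>
    (stream_of_mem_answers h x hx).imp_right fun h_le => h_le.trans (Nat.le_succ _)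
  | (u, some y) :: h, x, hx => by
    rcases List.mem_cons.1 hx with rfl | hx
    · simp
    · exact (stream_of_mem_answers h x hx).imp_right fun h_le => h_le.trans (Nat.le_succ _)

theorem allCorrect_iff_forall_mem_answers {f : (Fin n → ℤ) → ℝ} {α : ℝ} : ∀ {h : History n},
    AllCorrect f α h ↔ ∀ x ∈ h.answers, IsApprox α (f (freq x.1)) x.2
  | [] => by simp [AllCorrect, History.answers]
  | (_, none) :: h => allCorrect_iff_forall_mem_answers (h := h)
  | (u, some y) :: h => by
    rw [History.answers, List.forall_mem_cons, AllCorrect, allCorrect_iff_forall_mem_answers]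

theorem Adversary.QueryBounded.lt_of_query (hq : adv.QueryBounded q) {h : History n}
    {a : Update n × Bool} (ha : a ∈ (adv h).support) (ha_query : a.2 = true) : h.queries < q := by
  by_contra h_le
  simp [hq h (not_lt.1 h_le) a ha] at ha_query

/-- One round of the game against an answer oracle: a query made after the stream `us` is answered
by a fresh sample of `ans us`, whatever the earlier answers were. -/
def round (adv : Adversary n) (ans : List (Update n) → PMF ℝ) (h : History n) : PMF (History n) :=
  (adv h).bind fun a =>
    if a.2 = true then (ans (a.1 :: h.map Prod.fst)).map fun y => (a.1, some y) :: h
    else PMF.pure ((a.1, none) :: h)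

/-- The history after `j` more rounds of the game against the answer oracle `ans`. -/
def rounds (adv : Adversary n) (ans : List (Update n) → PMF ℝ) : ℕ → History n → PMF (History n)
  | 0, h => PMF.pure h
  | j + 1, h => (round adv ans h).bind (rounds adv ans j)

theorem rounds_succ (adv : Adversary n) (ans : List (Update n) → PMF ℝ) (j : ℕ) (h : History n) :
    rounds adv ans (j + 1) h = (adv h).bind fun a =>
      if a.2 = true then
        (ans (a.1 :: h.map Prod.fst)).bind fun y => rounds adv ans j ((a.1, some y) :: h)
      else rounds adv ans j ((a.1, none) :: h) := by
  rw [rounds, round, PMF.bind_bind]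
  congr! 2 with a
  split_ifs
  · exact PMF.bind_map _ _ _
  · exact PMF.pure_bind _ _

theorem rounds_succ_last (adv : Adversary n) (ans : List (Update n) → PMF ℝ) : ∀ (j : ℕ)
    (h : History n), rounds adv ans (j + 1) h = (rounds adv ans j h).bind (round adv ans)
  | 0, h => by simp only [rounds, PMF.bind_pure, PMF.pure_bind]
  | j + 1, h => by
    change _ = ((round adv ans h).bind (rounds adv ans j)).bind (round adv ans)
    rw [rounds, funext (rounds_succ_last adv ans j), PMF.bind_bind]

theorem rounds_congr {ans ans' : List (Update n) → PMF ℝ} : ∀ {j : ℕ} {h : History n},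
    (∀ us, us.length ≤ h.length + j → ans us = ans' us) → rounds adv ans j h = rounds adv ans' j h
  | 0, _, _ => rfl
  | j + 1, h, h_eq => by
    have ih : ∀ r, rounds adv ans j (r :: h) = rounds adv ans' j (r :: h) := fun r =>
      rounds_congr fun us hus => h_eq us (by rw [List.length_cons] at hus; omega)
    have h_ans : ∀ u, ans (u :: h.map Prod.fst) = ans' (u :: h.map Prod.fst) :=
      fun u => h_eq _ (by simp)
    simp only [rounds_succ, ih, h_ans]

theorem length_of_mem_support_rounds {ans : List (Update n) → PMF ℝ} : ∀ {j : ℕ} {h h' : History n},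
    h' ∈ (rounds adv ans j h).support → h'.length = h.length + j
  | 0, h, h', hh' => by rw [(PMF.mem_support_pure_iff _ _).1 hh', add_zero]
  | j + 1, h, h', hh' => by
    rw [rounds_succ, PMF.mem_support_bind_iff] at hh'
    obtain ⟨a, -, hh'⟩ := hh'
    split_ifs at hh'
    · obtain ⟨y, -, hh'⟩ := (PMF.mem_support_bind_iff _ _ _).1 hh'
      rw [length_of_mem_support_rounds hh', List.length_cons, add_right_comm, add_assoc]
    · rw [length_of_mem_support_rounds hh', List.length_cons, add_right_comm, add_assoc]

theorem queries_le_of_mem_support_rounds (hq : adv.QueryBounded q) {ans : List (Update n) → PMF ℝ} :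
    ∀ {j : ℕ} {h h' : History n}, h.queries ≤ q → h' ∈ (rounds adv ans j h).support →
      h'.queries ≤ q
  | 0, h, h', hh, hh' => by rwa [(PMF.mem_support_pure_iff _ _).1 hh']
  | j + 1, h, h', hh, hh' => by
    rw [rounds_succ, PMF.mem_support_bind_iff] at hh'
    obtain ⟨a, ha, hh'⟩ := hh'
    split_ifs at hh' with ha_query
    · obtain ⟨y, -, hh'⟩ := (PMF.mem_support_bind_iff _ _ _).1 hh'
      refine queries_le_of_mem_support_rounds hq ?_ hh'
      rw [History.queries_cons_some]
      exact hq.lt_of_query ha ha_query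
    · exact queries_le_of_mem_support_rounds hq (by rwa [History.queries_cons_none]) hh'

theorem sq_prob_rounds_le (hq : adv.QueryBounded q) {ans ans' : List (Update n) → PMF ℝ} {η : ℝ}
    (h_ans : ∀ us, Indistinguishable η (ans us) (ans' us)) (E : Set (History n)) :
    ∀ (j : ℕ) {h : History n}, h.queries ≤ q → prob (rounds adv ans j h) E ^ 2 ≤
      Real.exp (η ^ 2) ^ (q - h.queries) * prob (rounds adv ans' j h) E
  | 0, h, _ => by
    have h_sq : prob (PMF.pure h) E ^ 2 ≤ prob (PMF.pure h) E :=
      pow_le_of_le_one (prob_nonneg _ _) (prob_le_one _ _) two_ne_zero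
    exact h_sq.trans (le_mul_of_one_le_left (prob_nonneg _ _)
      (one_le_pow₀ (Real.one_le_exp (sq_nonneg η))))
  | j + 1, h, hh => by
    rw [rounds_succ, rounds_succ]
    refine sq_prob_bind_le _ _ _ _ _ fun a ha => ?_
    split_ifs with ha_query
    · have h_lt := hq.lt_of_query ha ha_query
      have h_pow : Real.exp (η ^ 2) ^ (q - h.queries) =
          Real.exp (η ^ 2) * Real.exp (η ^ 2) ^ (q - (h.queries + 1)) := by
        rw [← pow_succ', Nat.sub_add_eq, Nat.sub_add_cancel (Nat.sub_pos_of_lt h_lt)]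
      rw [h_pow]
      refine (h_ans _).sq_prob_bind_le _ _ _ _ fun y _ => ?_
      rw [← h.queries_cons_some a.1 y]
      exact sq_prob_rounds_le hq h_ans E j (by rwa [History.queries_cons_some])
    · rw [← h.queries_cons_none a.1]
      exact sq_prob_rounds_le hq h_ans E j (by rwa [History.queries_cons_none])

theorem prob_rounds_exists_mem_answers_le (hq : adv.QueryBounded q)
    {ans : List (Update n) → PMF ℝ} (P : List (Update n) → ℝ → Prop) {x : ℝ}
    (hP : ∀ us, prob (ans us) {y | P us y} ≤ x) : ∀ (j : ℕ) {h : History n}, h.queries ≤ q →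
      (∀ z ∈ h.answers, ¬ P z.1 z.2) →
        prob (rounds adv ans j h) {h' | ∃ z ∈ h'.answers, P z.1 z.2} ≤ (q - h.queries) * x
  | 0, h, hh, h_good => by
    have hx : 0 ≤ x := (prob_nonneg _ _).trans (hP [])
    have h_notMem : h ∉ {h' : History n | ∃ z ∈ h'.answers, P z.1 z.2} :=
      fun ⟨z, hz, hPz⟩ => h_good z hz hPz
    rw [rounds, prob_pure_of_notMem h_notMem]
    exact mul_nonneg (sub_nonneg.2 (Nat.cast_le.2 hh)) hx
  | j + 1, h, hh, h_good => by
    have hx : 0 ≤ x := (prob_nonneg _ _).trans (hP [])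
    rw [rounds_succ]
    refine prob_bind_le _ _ _ fun a ha => ?_
    split_ifs with ha_query
    · have h_lt := hq.lt_of_query ha ha_query
      have h_le : ((h.queries + 1 : ℕ) : ℝ) ≤ q := Nat.cast_le.2 h_lt
      set us := a.1 :: h.map Prod.fst
      have h_step : ∀ y ∈ (ans us).support, prob (rounds adv ans j ((a.1, some y) :: h))
          {h' | ∃ z ∈ h'.answers, P z.1 z.2} ≤
            (q - (h.queries + 1 : ℕ)) * x + 1 * prob (PMF.pure y) {y | P us y} := fun y _ => by
        by_cases hy : P us y
        · rw [prob_pure_of_mem (show y ∈ {y | P us y} from hy), mul_one]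
          exact le_add_of_nonneg_of_le (mul_nonneg (sub_nonneg.2 h_le) hx) (prob_le_one _ _)
        · rw [prob_pure_of_notMem (show y ∉ {y | P us y} from hy), mul_zero, add_zero,
            ← h.queries_cons_some a.1 y]
          refine prob_rounds_exists_mem_answers_le hq P hP j
            (by rwa [History.queries_cons_some]) ?_
          rw [History.answers, List.forall_mem_cons]
          exact ⟨hy, h_good⟩
      refine (prob_bind_le_affine _ _ _ _ _ h_step).trans ?_
      rw [PMF.bind_pure]
      push_cast
      linear_combination hP us
    · rw [← h.queries_cons_none a.1]
      exact prob_rounds_exists_mem_answers_le hq P hP j (by rwa [History.queries_cons_none]) h_good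

end Game

section Tables

variable {n k : ℕ} {α τ : ℝ}

namespace StreamAlg

/-- The joint law of the memory content `s` and of an estimate reported from it. -/
def reading (A : StreamAlg n) (s : A.State) : PMF (A.State × ℝ) := (A.out s).map (Prod.mk s)

/-- Extends a table that holds the memory content and the estimate of `A` for all streams of at most
`j` updates to the streams of `j + 1` updates, with fresh coins for each of these streams. -/
def tableExt (A : StreamAlg n) (j : ℕ) (T : List (Update n) → A.State × ℝ) :
    PMF (List (Update n) → A.State × ℝ) :=
  (indepFamily fun us : List.Vector (Update n) (j + 1) =>
      (A.step (T us.tail.toList).1 us.head).bind A.reading).map fun R us =>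
    if h : us.length = j + 1 then R ⟨us, h⟩ else T us

/-- The law of a table of presampled runs of `A`, indexed by the streams of at most `j` updates
(newest update first): streams with a common past share the coins flipped in that past. On longer
streams the values are arbitrary. -/
def tableLaw (A : StreamAlg n) : ℕ → PMF (List (Update n) → A.State × ℝ)
  | 0 => (A.init.bind A.reading).map fun x _ => x
  | j + 1 => (A.tableLaw j).bind (A.tableExt j)

variable (A : StreamAlg n) {j : ℕ} {us : List (Update n)}

theorem eq_of_mem_support_tableExt {T T' : List (Update n) → A.State × ℝ}
    (hT' : T' ∈ (A.tableExt j T).support) (h : us.length ≤ j) : T' us = T us := by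
  obtain ⟨R, -, rfl⟩ := (PMF.mem_support_map_iff _ _ _).1 hT'
  exact dif_neg (by omega)

theorem map_eval_tableExt (T : List (Update n) → A.State × ℝ) (u : Update n)
    (h : us.length = j) :
    (A.tableExt j T).map (fun T' => T' (u :: us)) = (A.step (T us).1 u).bind A.reading := by
  subst h
  rw [tableExt, PMF.map_comp]
  simp only [Function.comp_def, List.length_cons, dif_pos]
  exact map_eval_indepFamily (ι := List.Vector (Update n) (us.length + 1)) _ ⟨u :: us, rfl⟩

theorem bind_reading_bind_fst {H : Type*} (p : PMF A.State) (F : A.State → PMF H) :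
    ((p.bind A.reading).bind fun x => F x.1) = p.bind F := by
  simp only [reading, PMF.bind_bind, PMF.bind_map, Function.comp_def, PMF.bind_const]

theorem map_eval_tableLaw : ∀ {j : ℕ} {us : List (Update n)}, us.length ≤ j →
    (A.tableLaw j).map (fun T => T us) = (A.run us).bind A.reading
  | 0, us, h => by
    rw [List.eq_nil_of_length_eq_zero (Nat.le_zero.1 h), tableLaw, PMF.map_comp]
    exact PMF.map_id _
  | j + 1, us, h => by
    rw [tableLaw, PMF.map_bind]
    rcases Nat.le_succ_iff.1 h with h_le | h_eq
    · have h_const : ∀ T, (A.tableExt j T).map (fun T' => T' us) = PMF.pure (T us) := fun T =>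
        (bind_congr_of_mem_support fun T' hT' =>
          congrArg PMF.pure (A.eq_of_mem_support_tableExt hT' h_le)).trans (PMF.bind_const _ _)
      simp only [h_const]
      exact map_eval_tableLaw h_le
    · obtain ⟨u, us, rfl⟩ := List.exists_cons_of_length_eq_add_one h_eq
      have h_len : us.length = j := Nat.succ.inj h_eq
      simp only [A.map_eval_tableExt _ u h_len]
      calc (A.tableLaw j).bind (fun T => (A.step (T us).1 u).bind A.reading)
        _ = ((A.tableLaw j).map fun T => T us).bind fun x => (A.step x.1 u).bind A.reading :=
          (PMF.bind_map _ _ fun x : A.State × ℝ => (A.step x.1 u).bind A.reading).symm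
        _ = (A.run us).bind fun s => (A.step s u).bind A.reading := by
          rw [map_eval_tableLaw h_len.le, bind_reading_bind_fst A _ fun s => (A.step s u).bind _]
        _ = (A.run (u :: us)).bind A.reading := (PMF.bind_bind _ _ _).symm

theorem map_snd_eval_tableLaw (h : us.length ≤ j) :
    (A.tableLaw j).map (fun T => (T us).2) = A.estimate us := by
  have h_eval := congrArg (PMF.map Prod.snd) (A.map_eval_tableLaw h)
  rw [PMF.map_comp, PMF.map_bind] at h_eval
  simp only [reading, PMF.map_comp] at h_eval
  exact h_eval.trans (congrArg _ (funext fun s => PMF.map_id _))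

theorem indep_bind_reading_bind {H : Type*} (p : Fin k → PMF A.State)
    (F : (Fin k → A.State) → (Fin k → ℝ) → PMF H) :
    ((indep k fun i => (p i).bind A.reading).bind fun R => F (fun i => (R i).1) fun i => (R i).2) =
      (indep k p).bind fun s => (indep k fun i => A.out (s i)).bind (F s) := by
  simp only [reading, indep_bind, indep_map, PMF.bind_bind, PMF.bind_map, Function.comp_def]

end StreamAlg

/-- The law of the answer of `boundedQueryAlg` to a query at which the copies report the
estimates `y`. -/
def medianAnswer (M : (Fin k → grid α τ) → PMF (grid α τ)) (y : Fin k → ℝ) : PMF ℝ :=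
  (M fun i => roundGrid α τ (y i)).map Subtype.val

theorem boundedQueryAlg_out (A : StreamAlg n) (M : (Fin k → grid α τ) → PMF (grid α τ))
    (s : Fin k → A.State) : (boundedQueryAlg A α τ k M).out s =
      (indep k fun i => A.out (s i)).bind (medianAnswer M) := by
  change ((indep k fun i => (A.out (s i)).map (roundGrid α τ)).bind M).map Subtype.val = _
  rw [indep_map, PMF.bind_map, PMF.map_bind]
  rfl

theorem bind_round_tableExt (A : StreamAlg n) (M : (Fin k → grid α τ) → PMF (grid α τ))
    (adv : Adversary n) (T : Fin k → List (Update n) → A.State × ℝ) (h : History n) :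
    ((indep k fun i => A.tableExt h.length (T i)).bind fun T' =>
      (round adv (fun us => medianAnswer M fun i => (T' i us).2) h).map fun h' =>
        ((fun i => (T' i (h'.map Prod.fst)).1, h') : (Fin k → A.State) × History n)) =
    (adv h).bind fun a =>
      (indep k fun i => A.step (T i (h.map Prod.fst)).1 a.1).bind fun s =>
        if a.2 = true then
          ((boundedQueryAlg A α τ k M).out s).map fun y => (s, (a.1, some y) :: h)
        else PMF.pure (s, (a.1, none) :: h) := by
  simp only [round, PMF.map_bind]
  rw [PMF.bind_comm]
  congr! 2 with a
  have h_eval (F : (Fin k → A.State × ℝ) → PMF ((Fin k → A.State) × History n)) :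
      ((indep k fun i => A.tableExt h.length (T i)).bind fun T' =>
        F fun i => T' i (a.1 :: h.map Prod.fst)) =
      (indep k fun i => (A.step (T i (h.map Prod.fst)).1 a.1).bind A.reading).bind F := by
    simp only [← A.map_eval_tableExt _ _ (List.length_map Prod.fst), indep_map, PMF.bind_map]
    rfl
  cases a.2
  · simp only [Bool.false_eq_true, if_false, PMF.pure_map, List.map_cons]
    refine (h_eval fun R => PMF.pure (fun i => (R i).1, (a.1, none) :: h)).trans ?_
    rw [A.indep_bind_reading_bind _ fun s _ => PMF.pure (s, (a.1, none) :: h)]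
    simp only [PMF.bind_const]
  · simp only [if_true, PMF.map_comp, Function.comp_def, List.map_cons, boundedQueryAlg_out,
      PMF.map_bind]
    rw [← A.indep_bind_reading_bind _ fun s y =>
      (medianAnswer M y).map fun z => (s, (a.1, some z) :: h)]
    exact h_eval fun R => (medianAnswer M fun i => (R i).2).map fun z =>
      (fun i => (R i).1, (a.1, some z) :: h)

theorem play_boundedQueryAlg (A : StreamAlg n) (M : (Fin k → grid α τ) → PMF (grid α τ))
    (adv : Adversary n) : ∀ j : ℕ, (boundedQueryAlg A α τ k M).play adv j =
      (indep k fun _ => A.tableLaw j).bind fun T =>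
        (rounds adv (fun us => medianAnswer M fun i => (T i us).2) j []).map fun h =>
          (fun i => (T i (h.map Prod.fst)).1, h)
  | 0 => by
    simp only [rounds, PMF.pure_map, StreamAlg.tableLaw, indep_map, PMF.bind_map, Function.comp_def,
      List.map_nil]
    refine Eq.trans ?_ (A.indep_bind_reading_bind _ fun s _ => PMF.pure (s, [])).symm
    simp only [PMF.bind_const]
    rfl
  | j + 1 => by
    rw [StreamAlg.play, play_boundedQueryAlg A M adv j]
    simp only [StreamAlg.tableLaw, indep_bind, PMF.bind_bind]
    refine (PMF.bind_bind _ _ _).trans (congrArg _ (funext fun T => ?_))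
    refine (PMF.bind_map _ _ _).trans ?_
    have h_rounds : ∀ T' ∈ (indep k fun i => A.tableExt j (T i)).support,
        rounds adv (fun us => medianAnswer M fun i => (T' i us).2) (j + 1) [] =
          (rounds adv (fun us => medianAnswer M fun i => (T i us).2) j []).bind
            (round adv fun us => medianAnswer M fun i => (T' i us).2) := fun T' hT' => by
      rw [rounds_succ_last]
      congr 1
      refine rounds_congr fun us hus => congrArg _ (funext fun i => congrArg Prod.snd ?_)
      exact A.eq_of_mem_support_tableExt (mem_support_of_mem_support_indep hT' i)
        (by simpa using hus)
    rw [bind_congr_of_mem_support fun T' hT' => congrArg (PMF.map _) (h_rounds T' hT')]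
    simp only [PMF.map_bind]
    rw [PMF.bind_comm]
    refine bind_congr_of_mem_support fun h hh => ?_
    obtain rfl : h.length = j := by simpa using length_of_mem_support_rounds hh
    exact (bind_round_tableExt A M adv T h).symm

end Tables

section Rounding

variable {α τ y : ℝ}

theorem lt_pow_maxExp_add_one (hα : 0 < α) (hτ : 0 < τ) : τ < (1 + α / 3) ^ (maxExp α τ + 1) := by
  rw [← Real.rpow_natCast, ← Real.logb_lt_iff_lt_rpow (by linarith) hτ]
  exact_mod_cast Nat.lt_floor_add_one _

theorem min_le_roundVal (hα : 0 < α) (hτ : 0 < τ) (hy : 0 < y) :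
    min y (τ / (1 + α / 3)) ≤ roundVal α τ y := by
  have h_base : 1 < 1 + α / 3 := by linarith
  rw [roundVal, if_neg hy.not_ge,
    (pow_right_mono₀ h_base.le).map_min (a := ⌈Real.logb (1 + α / 3) y⌉₊) (b := maxExp α τ)]
  refine min_le_min ?_ ?_
  · rw [← Real.rpow_natCast, ← Real.logb_le_iff_le_rpow h_base hy]
    exact Nat.le_ceil _
  · rw [div_le_iff₀ (by linarith), ← pow_succ]
    exact (lt_pow_maxExp_add_one hα hτ).le

theorem roundVal_le_max (hα : 0 < α) (hy : 0 < y) :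
    roundVal α τ y ≤ max 1 ((1 + α / 3) * y) := by
  have h_base : 1 < 1 + α / 3 := by linarith
  rw [roundVal, if_neg hy.not_ge]
  refine (pow_le_pow_right₀ h_base.le (min_le_left _ _)).trans ?_
  rcases le_or_gt (Real.logb (1 + α / 3) y) 0 with h_nonpos | h_pos
  · rw [Nat.ceil_eq_zero.2 h_nonpos, pow_zero]
    exact le_max_left _ _
  · refine le_max_of_le_right ?_
    calc (1 + α / 3) ^ ⌈Real.logb (1 + α / 3) y⌉₊
        ≤ (1 + α / 3) ^ (Real.logb (1 + α / 3) y + 1) := by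
          rw [← Real.rpow_natCast]
          exact Real.rpow_le_rpow_of_exponent_le h_base.le (Nat.ceil_lt_add_one h_pos.le).le
      _ = (1 + α / 3) * y := by
          rw [Real.rpow_add_one (by linarith), Real.rpow_logb (by linarith) h_base.ne' hy, mul_comm]

theorem isApprox_roundVal {Q : ℝ} (hα : 0 < α) (hα1 : α < 1) (hQ : Q = 0 ∨ (1 ≤ Q ∧ Q ≤ τ))
    (h : IsApprox (α / 3) Q y) : IsApprox α Q (roundVal α τ y) := by
  obtain ⟨h_lower, h_upper⟩ := h
  rcases hQ with rfl | ⟨hQ1, hQτ⟩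
  · have hy : y = 0 := by linarith
    simp [IsApprox, roundVal, hy]
  have hy : 0 < y := by nlinarith
  constructor
  · refine le_trans (le_min ?_ ?_) (min_le_roundVal hα (by linarith) hy)
    · nlinarith
    · rw [le_div_iff₀ (by linarith)]
      nlinarith [mul_pos hα hα]
  · refine (roundVal_le_max hα hy).trans (max_le ?_ ?_) <;> nlinarith

end Rounding

section Robustness

variable {n k m q : ℕ} {α τ ε β Γ : ℝ} {adv : Adversary n} {A : StreamAlg n}
  {M : (Fin k → grid α τ) → PMF (grid α τ)}

/-- The joint law of the tables of presampled runs of the `k` copies of `A` and of the history of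
the game that `adv` plays against `boundedQueryAlg` with these tables. -/
def presampledPlay (A : StreamAlg n) (M : (Fin k → grid α τ) → PMF (grid α τ)) (adv : Adversary n)
    (m : ℕ) : PMF ((Fin k → List (Update n) → A.State × ℝ) × History n) :=
  (indep k fun _ => A.tableLaw m).bind fun T =>
    (rounds adv (fun us => medianAnswer M fun i => (T i us).2) m []).map (Prod.mk T)

theorem prob_play_boundedQueryAlg (A : StreamAlg n) (M : (Fin k → grid α τ) → PMF (grid α τ))
    (adv : Adversary n) (m : ℕ) (E : Set (History n)) :
    prob ((boundedQueryAlg A α τ k M).play adv m) {x | x.2 ∈ E} =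
      prob (presampledPlay A M adv m) {x | x.2 ∈ E} := by
  have h_snd : ((boundedQueryAlg A α τ k M).play adv m).map Prod.snd =
      (presampledPlay A M adv m).map Prod.snd := by
    rw [play_boundedQueryAlg, presampledPlay]
    refine (PMF.map_bind _ _ _).trans (.trans ?_ (PMF.map_bind _ _ _).symm)
    exact congrArg _ (funext fun T => (PMF.map_comp _ _ _).trans
      (PMF.map_comp (Prod.mk T) _ Prod.snd).symm)
  refine (prob_map _ Prod.snd E).symm.trans ((congrArg (prob · E) h_snd).trans ?_)
  exact prob_map _ Prod.snd E

theorem prob_exists_answer_forall_piecewise_mem_le {bad : List (Update n) → Set ℝ} {x : ℝ}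
    (hx : 0 ≤ x) (h_bad : ∀ us, us ≠ [] → us.length ≤ m → prob (A.estimate us) (bad us) ≤ x)
    (J : Finset (Fin k)) (T : Fin k → List (Update n) → A.State × ℝ) {h : History n}
    (h_len : h.length ≤ m) (h_num : h.queries ≤ q) :
    prob (indep k fun _ => A.tableLaw m)
      {T' | ∃ z ∈ h.answers, ∀ i ∈ J, (J.piecewise T' T i z.1).2 ∈ bad z.1} ≤ q * x ^ J.card := by
  have h_entry : ∀ z ∈ h.answers, prob (indep k fun _ => A.tableLaw m)
      {T' | ∀ i ∈ J, (J.piecewise T' T i z.1).2 ∈ bad z.1} ≤ x ^ J.card := fun z hz => by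
    obtain ⟨hz_ne, hz_len⟩ := h.stream_of_mem_answers z hz
    have hz_le : z.1.length ≤ m := hz_len.trans h_len
    have h_fresh : {T' : Fin k → List (Update n) → A.State × ℝ |
          ∀ i ∈ J, (J.piecewise T' T i z.1).2 ∈ bad z.1} =
        {T' | ∀ i ∈ J, T' i ∈ {t | (t z.1).2 ∈ bad z.1}} :=
      Set.ext fun T' => forall₂_congr fun i hi => by
        rw [Finset.piecewise_eq_of_mem _ _ _ hi, Set.mem_ofPred_eq]
    rw [h_fresh]
    refine prob_indep_forall_mem k _ J _ fun i _ => le_of_eq_of_le ?_ (h_bad z.1 hz_ne hz_le)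
    rw [← A.map_snd_eval_tableLaw hz_le, prob_map]
    rfl
  refine (prob_exists_mem_list_le _ _ h.answers h_entry).trans
    (mul_le_mul_of_nonneg_right ?_ (pow_nonneg hx _))
  rw [h.length_answers]
  exact_mod_cast h_num

theorem sq_prob_exists_answer_forall_mem_le (hq : adv.QueryBounded q) (hM : IsDP M ε 0)
    {bad : List (Update n) → Set ℝ} {x : ℝ} (hx : 0 ≤ x)
    (h_bad : ∀ us, us ≠ [] → us.length ≤ m → prob (A.estimate us) (bad us) ≤ x)
    (J : Finset (Fin k)) :
    prob (presampledPlay A M adv m)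
        {r | ∃ z ∈ r.2.answers, ∀ i ∈ J, (r.1 i z.1).2 ∈ bad z.1} ^ 2 ≤
      Real.exp ((J.card * ε) ^ 2) ^ q * (q * x ^ J.card) := by
  refine sq_prob_le_of_resample (fun _ => A.tableLaw m)
    (fun T => rounds adv (fun us => medianAnswer M fun i => (T i us).2) m []) J
    (fun T => {h | ∃ z ∈ h.answers, ∀ i ∈ J, (T i z.1).2 ∈ bad z.1})
    (pow_nonneg (Real.exp_nonneg _) q) (fun T T' hT F => ?_) fun T h hh => ?_
  · refine sq_prob_rounds_le hq (fun us => ?_) F m (Nat.zero_le q)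
    exact (hM.indistinguishable (J := J) fun i hi =>
      congrArg (fun t => roundGrid α τ (t us).2) (hT i hi)).map _
  · refine prob_exists_answer_forall_piecewise_mem_le hx h_bad J T ?_
      (queries_le_of_mem_support_rounds hq (h := []) (Nat.zero_le q) hh)
    rw [length_of_mem_support_rounds hh, List.length_nil, zero_add]

theorem choose_mul_prob_exists_answer_card_le (hq : adv.QueryBounded q) (hM : IsDP M ε 0)
    {bad : List (Update n) → Set ℝ} {x : ℝ} (hx : 0 ≤ x)
    (h_bad : ∀ us, us ≠ [] → us.length ≤ m → prob (A.estimate us) (bad us) ≤ x) (s b : ℕ) :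
    b.choose s * prob (presampledPlay A M adv m) {r | ∃ z ∈ r.2.answers,
        ∃ B : Finset (Fin k), b ≤ B.card ∧ ∀ i ∈ B, (r.1 i z.1).2 ∈ bad z.1} ≤
      k.choose s * √(Real.exp ((s * ε) ^ 2) ^ q * (q * x ^ s)) := by
  have h_count := choose_mul_prob_exists_card_le (s := s) (b := b) (presampledPlay A M adv m)
    (fun r (J : Finset (Fin k)) => ∃ z ∈ r.2.answers, ∀ i ∈ J, (r.1 i z.1).2 ∈ bad z.1)
    (fun r J J' hJ ⟨z, hz, h_all⟩ => ⟨z, hz, fun i hi => h_all i (hJ hi)⟩)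
    fun J hJ => Real.le_sqrt_of_sq_le <| hJ ▸
      sq_prob_exists_answer_forall_mem_le hq hM hx h_bad J
  rw [Fintype.card_fin] at h_count
  refine le_of_eq_of_le ?_ h_count
  congr! 3
  ext r
  exact ⟨fun ⟨z, hz, B, hB, h_all⟩ => ⟨B, hB, z, hz, h_all⟩,
    fun ⟨B, hB, z, hz, h_all⟩ => ⟨z, hz, B, hB, h_all⟩⟩

/-- `x` is a median of the rows of `D` up to a rank error `Γ`, as required of the output of a
private median. -/
def IsMedianUpTo {X : Type*} [LinearOrder X] (Γ : ℝ) (D : Fin k → X) (x : X) : Prop :=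
  (k : ℝ) / 2 - Γ ≤ ((Finset.univ.filter fun i => x ≤ D i).card : ℝ) ∧
    (k : ℝ) / 2 - Γ ≤ ((Finset.univ.filter fun i => D i ≤ x).card : ℝ)

theorem IsMedianUpTo.exists_between {X : Type*} [LinearOrder X] {D : Fin k → X} {x : X}
    (hx : IsMedianUpTo Γ D x) {b : ℕ} (hb : b ≤ (k : ℝ) / 2 - Γ) {good : X → Prop}
    (h_good : ¬ ∃ B : Finset (Fin k), b ≤ B.card ∧ ∀ i ∈ B, ¬ good (D i)) :
    ∃ i j, good (D i) ∧ good (D j) ∧ D i ≤ x ∧ x ≤ D j := by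
  have h_exists : ∀ R : Finset (Fin k), (k : ℝ) / 2 - Γ ≤ R.card → ∃ i ∈ R, good (D i) :=
    fun R hR => by
      by_contra! h_all
      exact h_good ⟨R, Nat.cast_le.1 (hb.trans hR), h_all⟩
  obtain ⟨j, hj, hj_good⟩ := h_exists _ hx.1
  obtain ⟨i, hi, hi_good⟩ := h_exists _ hx.2
  exact ⟨i, j, hi_good, hj_good, (Finset.mem_filter.1 hi).2, (Finset.mem_filter.1 hj).2⟩

theorem prob_medianAnswer_not_isMedianUpTo_le (hM : IsDPMedian M ε β Γ) (y : Fin k → ℝ) :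
    prob (medianAnswer M y) {z | ¬ IsMedianUpTo Γ (fun i => roundVal α τ (y i)) z} ≤ β := by
  set good := {z : grid α τ | IsMedianUpTo Γ (fun i => roundGrid α τ (y i)) z}
  have h_good : 1 - β ≤ prob (M fun i => roundGrid α τ (y i)) good := hM.2 _
  have h_compl := prob_compl (M fun i => roundGrid α τ (y i)) good
  rw [medianAnswer, prob_map]
  change prob _ goodᶜ ≤ β
  linarith

theorem prob_exists_answer_not_isMedianUpTo_le (hq : adv.QueryBounded q)
    (hM : IsDPMedian M ε β Γ) :
    prob (presampledPlay A M adv m) {r | ∃ z ∈ r.2.answers,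
        ¬ IsMedianUpTo Γ (fun i => roundVal α τ (r.1 i z.1).2) z.2} ≤ q * β := by
  refine prob_bind_le _ _ _ fun T _ => ?_
  rw [prob_map]
  refine (prob_rounds_exists_mem_answers_le hq
    (fun us y => ¬ IsMedianUpTo Γ (fun i => roundVal α τ (T i us).2) y)
    (fun us => prob_medianAnswer_not_isMedianUpTo_le hM _) m (h := []) (Nat.zero_le q)
    fun z hz => absurd hz List.not_mem_nil).trans_eq ?_
  simp [History.queries]

theorem StreamAlg.IsOblivious.prob_not_isApprox_roundVal_le {f : (Fin n → ℤ) → ℝ} {p : ℝ}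
    (hA : A.IsOblivious f (α / 3) m p) (hα : 0 < α) (hα1 : α < 1) {us : List (Update n)}
    (h_ne : us ≠ []) (h_len : us.length ≤ m)
    (hf : f (freq us) = 0 ∨ (1 ≤ f (freq us) ∧ f (freq us) ≤ τ)) :
    prob (A.estimate us) {y | ¬ IsApprox α (f (freq us)) (roundVal α τ y)} ≤ 1 - p := by
  have h_sub : {y | IsApprox (α / 3) (f (freq us)) y} ⊆
      {y | ¬ IsApprox α (f (freq us)) (roundVal α τ y)}ᶜ :=
    fun y hy => not_not.2 (isApprox_roundVal hα hα1 hf hy)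
  have h_good := (hA us h_ne h_len).trans (prob_mono _ h_sub)
  rw [prob_compl] at h_good
  linarith

theorem isRobust_boundedQueryAlg {f : (Fin n → ℤ) → ℝ} {p : ℝ} (hα : 0 < α) (hα1 : α < 1)
    (hf : ∀ us : List (Update n), us ≠ [] → us.length ≤ m →
      f (freq us) = 0 ∨ (1 ≤ f (freq us) ∧ f (freq us) ≤ τ))
    (hA : A.IsOblivious f (α / 3) m p) (hp : p ≤ 1) (hM : IsDPMedian M ε β Γ) {s b : ℕ}
    (hsb : s ≤ b) (hb : (b : ℝ) ≤ k / 2 - Γ) :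
    (boundedQueryAlg A α τ k M).IsRobust f α m q
      (1 - (k.choose s / b.choose s * √(Real.exp ((s * ε) ^ 2) ^ q * (q * (1 - p) ^ s)) +
        q * β)) := by
  intro adv hq
  set bad := fun us => {y | ¬ IsApprox α (f (freq us)) (roundVal α τ y)}
  have h_bad : ∀ us, us ≠ [] → us.length ≤ m → prob (A.estimate us) (bad us) ≤ 1 - p :=
    fun us h_ne h_len => hA.prob_not_isApprox_roundVal_le hα hα1 h_ne h_len (hf us h_ne h_len)
  set manyBad := {r : (Fin k → List (Update n) → A.State × ℝ) × History n | ∃ z ∈ r.2.answers,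
    ∃ B : Finset (Fin k), b ≤ B.card ∧ ∀ i ∈ B, (r.1 i z.1).2 ∈ bad z.1}
  set offMedian := {r : (Fin k → List (Update n) → A.State × ℝ) × History n | ∃ z ∈ r.2.answers,
    ¬ IsMedianUpTo Γ (fun i => roundVal α τ (r.1 i z.1).2) z.2}
  have h_manyBad : prob (presampledPlay A M adv m) manyBad ≤
      k.choose s / b.choose s * √(Real.exp ((s * ε) ^ 2) ^ q * (q * (1 - p) ^ s)) := by
    rw [div_mul_eq_mul_div, le_div_iff₀' (Nat.cast_pos.2 (Nat.choose_pos hsb))]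
    exact choose_mul_prob_exists_answer_card_le hq hM.1 (sub_nonneg.2 hp) h_bad s b
  have h_offMedian : prob (presampledPlay A M adv m) offMedian ≤ q * β :=
    prob_exists_answer_not_isMedianUpTo_le hq hM
  have h_wrong : {r | r.2 ∈ {h | AllCorrect f α h}}ᶜ ⊆ manyBad ∪ offMedian := fun r hr => by
    by_contra h_notMem
    obtain ⟨h_notManyBad, h_notOffMedian⟩ := not_or.1 h_notMem
    refine hr (allCorrect_iff_forall_mem_answers.2 fun z hz => ?_)
    obtain ⟨i, j, hi, hj, h_ge, h_le⟩ := IsMedianUpTo.exists_between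
      (by_contra fun h_med => h_notOffMedian ⟨z, hz, h_med⟩) hb (good := IsApprox α (f (freq z.1)))
      fun h_many => h_notManyBad ⟨z, hz, h_many⟩
    exact ⟨hi.1.trans h_ge, h_le.trans hj.2⟩
  refine le_of_le_of_eq ?_ (prob_play_boundedQueryAlg A M adv m {h | AllCorrect f α h}).symm
  have h_fail := (prob_mono (presampledPlay A M adv m) h_wrong).trans (prob_union_le _ _ _)
  rw [prob_compl] at h_fail
  linarith

end Robustness

section ExponentialMechanism

variable {X : Type*} [Fintype X] [Nonempty X] {u v : X → ℝ}

theorem sum_exp_pos (u : X → ℝ) : 0 < ∑ x, Real.exp (u x) :=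
  Finset.sum_pos (fun x _ => Real.exp_pos (u x)) Finset.univ_nonempty

/-- The exponential mechanism: a law on a finite type under which the probability of `x` is
proportional to `exp (u x)`. The scaling of the score by the privacy parameter is part of `u`. -/
def expMechanism (u : X → ℝ) : PMF X :=
  PMF.ofFintype (fun x => ENNReal.ofReal (Real.exp (u x) / ∑ y, Real.exp (u y))) <| by
    rw [← ENNReal.ofReal_sum_of_nonneg fun x _ => (div_pos (Real.exp_pos _) (sum_exp_pos u)).le,
      ← Finset.sum_div, div_self (sum_exp_pos u).ne', ENNReal.ofReal_one]

theorem expMechanism_apply_toReal (u : X → ℝ) (x : X) :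
    (expMechanism u x).toReal = Real.exp (u x) / ∑ y, Real.exp (u y) :=
  ENNReal.toReal_ofReal (div_pos (Real.exp_pos _) (sum_exp_pos u)).le

theorem expMechanism_apply_toReal_le_mul {η : ℝ} (h : ∀ x, |u x - v x| ≤ η) (x : X) :
    (expMechanism u x).toReal ≤ Real.exp (2 * η) * (expMechanism v x).toReal := by
  have h_sum : ∑ y, Real.exp (v y) ≤ Real.exp η * ∑ y, Real.exp (u y) := by
    rw [Finset.mul_sum]
    refine Finset.sum_le_sum fun y _ => ?_
    rw [← Real.exp_add, Real.exp_le_exp]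
    linarith [(abs_le.1 (h y)).1]
  rw [expMechanism_apply_toReal, expMechanism_apply_toReal, ← mul_div_assoc,
    div_le_div_iff₀ (sum_exp_pos u) (sum_exp_pos v)]
  calc Real.exp (u x) * ∑ y, Real.exp (v y)
      ≤ Real.exp (η + v x) * (Real.exp η * ∑ y, Real.exp (u y)) := by
        gcongr
        linarith [(abs_le.1 (h x)).2]
    _ = Real.exp (2 * η) * Real.exp (v x) * ∑ y, Real.exp (u y) := by
        rw [two_mul, Real.exp_add, Real.exp_add]
        ring

theorem prob_expMechanism_le_mul {η : ℝ} (h : ∀ x, |u x - v x| ≤ η) (T : Set X) :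
    prob (expMechanism u) T ≤ Real.exp (2 * η) * prob (expMechanism v) T := by
  refine hasSum_le (fun x => ?_) (hasSum_prob _ T) ((hasSum_prob _ T).mul_left _)
  by_cases hx : x ∈ T
  · simpa only [Set.indicator_of_mem hx] using expMechanism_apply_toReal_le_mul h x
  · simp only [Set.indicator_of_notMem hx, mul_zero, le_refl]

theorem expMechanism_apply_toReal_le (u : X → ℝ) (x x₀ : X) :
    (expMechanism u x).toReal ≤ Real.exp (u x - u x₀) := by
  rw [expMechanism_apply_toReal, Real.exp_sub]
  gcongr
  exact Finset.single_le_sum (f := fun y => Real.exp (u y)) (fun y _ => (Real.exp_pos _).le)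
    (Finset.mem_univ x₀)

theorem prob_expMechanism_le {E : Set X} {x₀ : X} {t : ℝ} (h : ∀ x ∈ E, u x ≤ u x₀ - t) :
    prob (expMechanism u) E ≤ Fintype.card X * Real.exp (-t) := by
  calc prob (expMechanism u) E ≤ ∑ _x : X, Real.exp (-t) := by
        refine hasSum_le (fun x => ?_) (hasSum_prob _ E) (hasSum_fintype _)
        refine Set.indicator_apply_le' (fun hx => ?_) fun _ => (Real.exp_pos _).le
        refine (expMechanism_apply_toReal_le u x x₀).trans (Real.exp_le_exp.2 ?_)
        linarith [h x hx]
    _ = Fintype.card X * Real.exp (-t) := by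
        rw [Finset.sum_const, Finset.card_univ, nsmul_eq_mul]

end ExponentialMechanism

section PrivateMedian

variable {k : ℕ} {X : Type*}

theorem card_filter_le_succ {D D' : Fin k → X} {i : Fin k} (h : ∀ j, j ≠ i → D j = D' j)
    (R : X → Prop) [DecidablePred R] : (Finset.univ.filter fun j => R (D j)).card ≤
      (Finset.univ.filter fun j => R (D' j)).card + 1 := by
  refine (Finset.card_le_card fun j hj => ?_).trans
    (Finset.card_insert_le i (Finset.univ.filter fun j => R (D' j)))
  by_cases hji : j = i
  · exact Finset.mem_insert.2 (Or.inl hji)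
  · rw [Finset.mem_filter_univ, h j hji] at hj
    exact Finset.mem_insert_of_mem ((Finset.mem_filter_univ j).2 hj)

variable [LinearOrder X]

/-- The smaller one of the numbers of rows that are at least `x` and at most `x`: the score by
which the exponential mechanism selects a median. -/
def medianScore (D : Fin k → X) (x : X) : ℕ :=
  min (Finset.univ.filter fun i => x ≤ D i).card (Finset.univ.filter fun i => D i ≤ x).card

theorem medianScore_le_succ {D D' : Fin k → X} {i : Fin k} (h : ∀ j, j ≠ i → D j = D' j) (x : X) :
    medianScore D x ≤ medianScore D' x + 1 := by
  rw [medianScore, medianScore, ← min_add_add_right]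
  exact min_le_min (card_filter_le_succ h (x ≤ ·)) (card_filter_le_succ h (· ≤ x))

theorem isMedianUpTo_iff_le_medianScore {D : Fin k → X} {x : X} {Γ : ℝ} :
    IsMedianUpTo Γ D x ↔ (k : ℝ) / 2 - Γ ≤ medianScore D x := by
  rw [IsMedianUpTo, medianScore, Nat.cast_min, le_min_iff]

theorem exists_le_two_mul_medianScore [Nonempty X] (D : Fin k → X) :
    ∃ x, k ≤ 2 * medianScore D x := by
  rcases k.eq_zero_or_pos with rfl | hk
  · exact ⟨Classical.arbitrary X, Nat.zero_le _⟩
  set σ := Tuple.sort D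
  have h_mono : Monotone (D ∘ σ) := Tuple.monotone_sort D
  set mid : Fin k := ⟨k / 2, Nat.div_lt_self hk one_lt_two⟩
  refine ⟨D (σ mid), ?_⟩
  have h_above : (Finset.Ici mid).card ≤ (Finset.univ.filter fun i => D (σ mid) ≤ D i).card :=
    Finset.card_le_card_of_injOn σ (fun j hj =>
      (Finset.mem_filter_univ _).2 (h_mono (Finset.mem_Ici.1 hj))) σ.injective.injOn
  have h_below : (Finset.Iic mid).card ≤ (Finset.univ.filter fun i => D i ≤ D (σ mid)).card :=
    Finset.card_le_card_of_injOn σ (fun j hj =>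
      (Finset.mem_filter_univ _).2 (h_mono (Finset.mem_Iic.1 hj))) σ.injective.injOn
  rw [Fin.card_Ici] at h_above
  rw [Fin.card_Iic] at h_below
  have h_mid : (mid : ℕ) = k / 2 := rfl
  rw [medianScore]
  omega

theorem isDP_expMechanism_medianScore [Fintype X] [Nonempty X] {ε : ℝ} (hε : 0 ≤ ε) :
    IsDP (fun D : Fin k → X => expMechanism fun x => ε / 2 * medianScore D x) ε 0 := by
  rintro D D' ⟨i, hi⟩ T
  have h_score : ∀ x, |ε / 2 * medianScore D x - ε / 2 * medianScore D' x| ≤ ε / 2 := fun x => by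
    have h_le : (medianScore D x : ℝ) ≤ medianScore D' x + 1 := by
      exact_mod_cast medianScore_le_succ hi x
    have h_ge : (medianScore D' x : ℝ) ≤ medianScore D x + 1 := by
      exact_mod_cast medianScore_le_succ (fun j hj => (hi j hj).symm) x
    rw [← mul_sub, abs_mul, abs_of_nonneg (div_nonneg hε zero_le_two)]
    refine mul_le_of_le_one_right (div_nonneg hε zero_le_two) (abs_le.2 ⟨?_, ?_⟩) <;> linarith
  simpa [mul_div_cancel₀] using prob_expMechanism_le_mul h_score T

theorem isDPMedian_expMechanism_medianScore [Fintype X] [Nonempty X] {ε β Γ : ℝ} (hε : 0 < ε)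
    (hβ : 0 < β) (hΓ : 2 * ε⁻¹ * Real.log (Fintype.card X / β) ≤ Γ) :
    IsDPMedian (fun D : Fin k → X => expMechanism fun x => ε / 2 * medianScore D x) ε β Γ := by
  refine ⟨isDP_expMechanism_medianScore hε.le, fun D => ?_⟩
  change 1 - β ≤ prob _ {x | IsMedianUpTo Γ D x}
  obtain ⟨x₀, hx₀⟩ := exists_le_two_mul_medianScore D
  have h_bad : ∀ x ∈ {x | IsMedianUpTo Γ D x}ᶜ,
      ε / 2 * medianScore D x ≤ ε / 2 * medianScore D x₀ - ε / 2 * Γ := fun x hx => by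
    have hx_lt : (medianScore D x : ℝ) < k / 2 - Γ :=
      not_le.1 fun h_le => hx (isMedianUpTo_iff_le_medianScore.2 h_le)
    have hx₀_le : (k : ℝ) ≤ 2 * medianScore D x₀ := by exact_mod_cast hx₀
    rw [← mul_sub]
    gcongr
    linarith
  have h_log : Real.log (Fintype.card X / β) ≤ ε / 2 * Γ := by
    calc Real.log (Fintype.card X / β)
        = ε / 2 * (2 * ε⁻¹ * Real.log (Fintype.card X / β)) := by field_simp
      _ ≤ ε / 2 * Γ := by gcongr
  have h_fail := prob_expMechanism_le h_bad
  rw [prob_compl] at h_fail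
  have h_le : Fintype.card X * Real.exp (-(ε / 2 * Γ)) ≤ β := by
    rw [Real.exp_neg, ← div_eq_mul_inv, div_le_comm₀ (Real.exp_pos _) hβ]
    have h_pos : 0 < Fintype.card X / β := div_pos (Nat.cast_pos.2 Fintype.card_pos) hβ
    exact (Real.log_le_iff_le_exp h_pos).1 h_log
  linarith

end PrivateMedian

section Parameters

variable {q : ℕ} {α δ τ : ℝ}

theorem log_two_le_log_div (hq : 1 ≤ q) (hδ : 0 < δ) (hδ1 : δ < 1) :
    Real.log 2 ≤ Real.log (2 * q / δ) := by
  have : (1 : ℝ) ≤ q := by exact_mod_cast hq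
  refine Real.log_le_log two_pos ?_
  rw [le_div_iff₀ hδ]
  nlinarith

theorem log_one_div_deltaPrime : Real.log (1 / deltaPrime q δ) = Real.log (1000 * q / δ) := by
  rw [deltaPrime, epsTotal, one_div_div, div_mul_eq_mul_div, one_mul, div_div_eq_mul_div]
  ring_nf

theorem log_div_le_log_one_div_deltaPrime (hq : 1 ≤ q) (hδ : 0 < δ) :
    Real.log (2 * q / δ) ≤ Real.log (1 / deltaPrime q δ) := by
  have : (0 : ℝ) < q := Nat.cast_pos.2 hq
  rw [log_one_div_deltaPrime]
  refine Real.log_le_log (by positivity) ?_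
  gcongr
  norm_num

theorem log_one_div_deltaPrime_le (hq : 1 ≤ q) (hδ : 0 < δ) (hδ1 : δ < 1) :
    Real.log (1 / deltaPrime q δ) ≤ 10 * Real.log (2 * q / δ) := by
  have : (0 : ℝ) < q := Nat.cast_pos.2 hq
  have h_500 : Real.log 500 ≤ 9 * Real.log 2 := by
    rw [← Real.log_rpow two_pos]
    exact Real.log_le_log (by norm_num) (by norm_num)
  rw [log_one_div_deltaPrime, show 1000 * q / δ = 500 * (2 * q / δ) by ring,
    Real.log_mul (by norm_num) (by positivity)]
  linarith [log_two_le_log_div hq hδ hδ1]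

theorem neg_three_mul_log_two_le : -(3 * Real.log 2) ≤ 4 * Real.log (Real.log 2) := by
  have h_log_two : 0 < Real.log 2 := Real.log_pos one_lt_two
  have h_one_le : 1 ≤ Real.log 2 ^ 4 * 2 ^ 3 := by
    have h_pow : (0.69 : ℝ) ^ 4 ≤ Real.log 2 ^ 4 := by
      gcongr
      linarith [Real.log_two_gt_d9]
    linarith
  have h_log := Real.log_nonneg h_one_le
  rw [Real.log_mul (by positivity) (by positivity), Real.log_pow, Real.log_pow] at h_log
  push_cast at h_log
  linarith

theorem log_div_le_four_mul_log (hq : 1 ≤ q) (hα : 0 < α) (hα1 : α < 1) (hδ : 0 < δ)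
    (hδ1 : δ < 1) (hτ : 1 ≤ τ) :
    Real.log (2 * q / δ) ≤ 4 * Real.log (2 * q * Real.log (2 * τ) / (α * δ)) := by
  have : (0 : ℝ) < q := Nat.cast_pos.2 hq
  have h_log_two : 0 < Real.log 2 := Real.log_pos one_lt_two
  have h_log_mono : Real.log 2 ≤ Real.log (2 * τ) := Real.log_le_log two_pos (by linarith)
  have h_arg : 2 * q / δ * Real.log 2 ≤ 2 * q * Real.log (2 * τ) / (α * δ) := by
    calc 2 * q / δ * Real.log 2 = 2 * q * Real.log 2 / (1 * δ) := by ring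
      _ ≤ 2 * q * Real.log (2 * τ) / (α * δ) := by
        have h_log_nonneg : 0 ≤ Real.log (2 * τ) := h_log_two.le.trans h_log_mono
        gcongr
  have h_log := Real.log_le_log (by positivity) h_arg
  rw [Real.log_mul (by positivity) (by positivity)] at h_log
  linarith [log_two_le_log_div hq hδ hδ1, neg_three_mul_log_two_le]

theorem zero_mem_grid (α τ : ℝ) : 0 ∈ grid α τ := Finset.mem_insert_self _ _

theorem card_grid_le_maxExp_add_two (α τ : ℝ) : (grid α τ).card ≤ maxExp α τ + 2 :=
  (Finset.card_insert_le _ _).trans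
    (Nat.succ_le_succ (Finset.card_image_le.trans (Finset.card_range _).le))

theorem maxExp_le (hα : 0 < α) (hα1 : α < 1) (hτ : 1 ≤ τ) :
    (maxExp α τ : ℝ) ≤ 4 * Real.log τ / α := by
  have h_base : α / 4 ≤ Real.log (1 + α / 3) := by
    refine le_trans ?_ (Real.one_sub_inv_le_log_of_pos (by linarith))
    rw [← one_div, le_sub_iff_add_le, ← le_sub_iff_add_le', div_le_iff₀ (by linarith)]
    nlinarith
  calc (maxExp α τ : ℝ) ≤ Real.log τ / Real.log (1 + α / 3) :=
        Nat.floor_le (Real.logb_nonneg (by linarith) hτ)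
    _ ≤ Real.log τ / (α / 4) := by
        have h_log : 0 ≤ Real.log τ := Real.log_nonneg hτ
        gcongr
    _ = 4 * Real.log τ / α := by field_simp

theorem card_grid_le (hα : 0 < α) (hα1 : α < 1) (hτ : 1 ≤ τ) :
    ((grid α τ).card : ℝ) ≤ 4 * Real.log (2 * τ) / α := by
  have h_card : ((grid α τ).card : ℝ) ≤ maxExp α τ + 2 := by
    exact_mod_cast card_grid_le_maxExp_add_two α τ
  have h_two : (2 : ℝ) ≤ 4 * Real.log 2 / α := by
    rw [le_div_iff₀ hα]
    linarith [Real.log_two_gt_d9]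
  rw [Real.log_mul two_ne_zero (by linarith), mul_add, add_div]
  linarith [maxExp_le hα hα1 hτ]

theorem log_card_grid_div_le (hq : 1 ≤ q) (hα : 0 < α) (hα1 : α < 1) (hδ : 0 < δ) (hδ1 : δ < 1)
    (hτ : 1 ≤ τ) : Real.log ((grid α τ).card / (δ / (2 * q))) ≤
      9 * Real.log (2 * q * Real.log (2 * τ) / (α * δ)) := by
  have : (0 : ℝ) < q := Nat.cast_pos.2 hq
  have hτ_log : 0 < Real.log (2 * τ) := Real.log_pos (by linarith)
  have h_card : (0 : ℝ) < (grid α τ).card := by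
    exact_mod_cast Finset.card_pos.2 ⟨0, zero_mem_grid α τ⟩
  have h_arg : (grid α τ).card / (δ / (2 * q)) ≤
      2 ^ 2 * (2 * q * Real.log (2 * τ) / (α * δ)) := by
    calc (grid α τ).card / (δ / (2 * q)) ≤ 4 * Real.log (2 * τ) / α / (δ / (2 * q)) := by
          gcongr
          exact card_grid_le hα hα1 hτ
      _ = 2 ^ 2 * (2 * q * Real.log (2 * τ) / (α * δ)) := by
          field_simp
          norm_num
  have h_log := Real.log_le_log (by positivity) h_arg
  rw [Real.log_mul (by norm_num) (by positivity), Real.log_pow] at h_log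
  push_cast at h_log
  linarith [log_two_le_log_div hq hδ hδ1, log_div_le_four_mul_log hq hα hα1 hδ hδ1 hτ]

theorem log_card_grid_div_nonneg (hq : 1 ≤ q) (hδ : 0 < δ) (hδ1 : δ < 1) :
    0 ≤ Real.log ((grid α τ).card / (δ / (2 * q))) := by
  have : (1 : ℝ) ≤ q := by exact_mod_cast hq
  have h_card : (1 : ℝ) ≤ (grid α τ).card := by
    exact_mod_cast Finset.card_pos.2 ⟨0, zero_mem_grid α τ⟩
  refine Real.log_nonneg ((one_le_div (by positivity)).2 (le_trans ?_ h_card))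
  rw [div_le_one (by positivity)]
  linarith

theorem inv_epsPrime :
    (epsPrime q δ)⁻¹ = 100 * √(8 * q * Real.log (1 / deltaPrime q δ)) := by
  rw [epsPrime, inv_div, epsTotal]
  ring

theorem hundred_le_inv_epsPrime (hq : 1 ≤ q) (hδ : 0 < δ) (hδ1 : δ < 1) :
    100 ≤ (epsPrime q δ)⁻¹ := by
  have : (1 : ℝ) ≤ q := by exact_mod_cast hq
  have h_log := (log_two_le_log_div hq hδ hδ1).trans (log_div_le_log_one_div_deltaPrime hq hδ)
  have h_sqrt : 1 ≤ √(8 * q * Real.log (1 / deltaPrime q δ)) := by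
    rw [Real.one_le_sqrt]
    nlinarith [Real.log_two_gt_d9]
  rw [inv_epsPrime]
  linarith

theorem inv_epsPrime_le (hq : 1 ≤ q) (hδ : 0 < δ) (hδ1 : δ < 1) :
    (epsPrime q δ)⁻¹ ≤ 900 * √(q * Real.log (2 * q / δ)) := by
  have h_log : 0 ≤ Real.log (2 * q / δ) :=
    (Real.log_nonneg one_le_two).trans (log_two_le_log_div hq hδ hδ1)
  rw [inv_epsPrime]
  calc 100 * √(8 * q * Real.log (1 / deltaPrime q δ))
      ≤ 100 * √(8 * q * (10 * Real.log (2 * q / δ))) := by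
        gcongr
        exact log_one_div_deltaPrime_le hq hδ hδ1
    _ ≤ 100 * √(9 ^ 2 * (q * Real.log (2 * q / δ))) := by
        refine mul_le_mul_of_nonneg_left (Real.sqrt_le_sqrt ?_) (by norm_num)
        linarith [mul_nonneg q.cast_nonneg h_log]
    _ = 900 * √(q * Real.log (2 * q / δ)) := by
        rw [Real.sqrt_mul (by norm_num), Real.sqrt_sq (by norm_num)]
        ring

end Parameters

section FailureProbability

variable {q : ℕ} {δ : ℝ}

theorem descFactorial_le_pow_mul_descFactorial {k b s : ℕ} (hs : 20 * s ≤ k)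
    (hb : 9 * k ≤ 20 * b) :
    (k.descFactorial s : ℝ) ≤ (5 / 2) ^ s * b.descFactorial s := by
  induction s with
  | zero => simp
  | succ s ih =>
    have h_factor : (k : ℝ) - s ≤ 5 / 2 * (b - s) := by
      have h_nat : (2 * k + 3 * s : ℝ) ≤ 5 * b := by
        exact_mod_cast (show 2 * k + 3 * s ≤ 5 * b by omega)
      linarith
    have h_nonneg : (0 : ℝ) ≤ b - s := sub_nonneg.2 (by exact_mod_cast (show s ≤ b by omega))
    rw [Nat.descFactorial_succ, Nat.descFactorial_succ, Nat.cast_mul, Nat.cast_mul,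
      Nat.cast_sub (by omega), Nat.cast_sub (by omega)]
    calc ((k : ℝ) - s) * k.descFactorial s
        ≤ (5 / 2 * (b - s)) * ((5 / 2) ^ s * b.descFactorial s) := by
          gcongr
          exact ih (by omega)
      _ = (5 / 2) ^ (s + 1) * ((b - s) * b.descFactorial s) := by ring

theorem choose_le_pow_mul_choose {k b s : ℕ} (hs : 20 * s ≤ k) (hb : 9 * k ≤ 20 * b) :
    (k.choose s : ℝ) ≤ (5 / 2) ^ s * b.choose s := by
  have h_desc := descFactorial_le_pow_mul_descFactorial hs hb
  rw [Nat.descFactorial_eq_factorial_mul_choose, Nat.descFactorial_eq_factorial_mul_choose,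
    Nat.cast_mul, Nat.cast_mul, mul_left_comm] at h_desc
  exact le_of_mul_le_mul_left h_desc (Nat.cast_pos.2 s.factorial_pos)

/-- The number of rows that are resampled together in the robustness argument. It is large enough
for the failure probability `q * (4 / 5) ^ groupSize q δ` of that argument to be at most `δ / 2`. -/
def groupSize (q : ℕ) (δ : ℝ) : ℕ := ⌈5 * Real.log (2 * q / δ)⌉₊

theorem groupSize_le (hq : 1 ≤ q) (hδ : 0 < δ) (hδ1 : δ < 1) :
    (groupSize q δ : ℝ) ≤ 7 * Real.log (2 * q / δ) := by
  have h_log := log_two_le_log_div hq hδ hδ1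
  have h_log_two := Real.log_two_gt_d9
  have h_ceil : (groupSize q δ : ℝ) < 5 * Real.log (2 * q / δ) + 1 :=
    Nat.ceil_lt_add_one (by linarith)
  linarith

theorem mul_sq_groupSize_mul_epsPrime_le (hq : 1 ≤ q) (hδ : 0 < δ) (hδ1 : δ < 1) :
    q * (groupSize q δ * epsPrime q δ) ^ 2 ≤ groupSize q δ * (1 / 10000) := by
  have : (0 : ℝ) < q := Nat.cast_pos.2 hq
  set ℓ := Real.log (1 / deltaPrime q δ) with hℓ
  have hℓ_ge : Real.log (2 * q / δ) ≤ ℓ := log_div_le_log_one_div_deltaPrime hq hδ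
  have hℓ_pos : 0 < ℓ :=
    (Real.log_pos one_lt_two).trans_le ((log_two_le_log_div hq hδ hδ1).trans hℓ_ge)
  have h_size : (groupSize q δ : ℝ) ≤ 7 * ℓ := (groupSize_le hq hδ hδ1).trans (by gcongr)
  have h_eps : epsPrime q δ ^ 2 = (10000 * (8 * q * ℓ))⁻¹ := by
    rw [← inv_inv (epsPrime q δ), inv_epsPrime, ← hℓ, inv_pow, mul_pow,
      Real.sq_sqrt (by positivity)]
    norm_num
  calc q * (groupSize q δ * epsPrime q δ) ^ 2
      = groupSize q δ * (groupSize q δ / (8 * ℓ) * (1 / 10000)) := by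
        rw [mul_pow, h_eps]
        field_simp
    _ ≤ groupSize q δ * (1 * (1 / 10000)) := by
        gcongr
        exact (div_le_one (by positivity)).2 (by linarith)
    _ = groupSize q δ * (1 / 10000) := by rw [one_mul]

theorem exp_sq_groupSize_mul_epsPrime_le (hq : 1 ≤ q) (hδ : 0 < δ) (hδ1 : δ < 1) :
    Real.exp ((groupSize q δ * epsPrime q δ) ^ 2) ^ q ≤ (128 / 125) ^ groupSize q δ := by
  have h_exp : Real.exp (1 / 10000) ≤ 128 / 125 := by
    refine (Real.exp_bound_div_one_sub_of_interval (by norm_num) (by norm_num)).trans ?_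
    norm_num
  calc Real.exp ((groupSize q δ * epsPrime q δ) ^ 2) ^ q
      = Real.exp (q * (groupSize q δ * epsPrime q δ) ^ 2) := (Real.exp_nat_mul _ _).symm
    _ ≤ Real.exp (groupSize q δ * (1 / 10000)) :=
        Real.exp_le_exp.2 (mul_sq_groupSize_mul_epsPrime_le hq hδ hδ1)
    _ = Real.exp (1 / 10000) ^ groupSize q δ := Real.exp_nat_mul _ _
    _ ≤ (128 / 125) ^ groupSize q δ := by gcongr

theorem mul_pow_groupSize_le (hq : 1 ≤ q) (hδ : 0 < δ) :
    q * (4 / 5 : ℝ) ^ groupSize q δ ≤ δ / 2 := by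
  have : (0 : ℝ) < q := Nat.cast_pos.2 hq
  have h_size : 5 * Real.log (2 * q / δ) ≤ groupSize q δ := Nat.le_ceil _
  calc q * (4 / 5 : ℝ) ^ groupSize q δ ≤ q * Real.exp (-(1 / 5)) ^ groupSize q δ := by
        gcongr
        linarith [Real.add_one_le_exp (-(1 / 5))]
    _ = q * Real.exp (-(groupSize q δ / 5)) := by
        rw [← Real.exp_nat_mul]
        ring_nf
    _ ≤ q * Real.exp (-Real.log (2 * q / δ)) := by
        gcongr
        linarith
    _ = δ / 2 := by
        rw [Real.exp_neg, Real.exp_log (by positivity)]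
        field_simp

theorem sqrt_exp_pow_mul_le (hq : 1 ≤ q) (hδ : 0 < δ) (hδ1 : δ < 1) :
    √(Real.exp ((groupSize q δ * epsPrime q δ) ^ 2) ^ q * (q * (1 - 9 / 10) ^ groupSize q δ)) ≤
      q * (8 / 25) ^ groupSize q δ := by
  have hq' : (1 : ℝ) ≤ q := by exact_mod_cast hq
  refine Real.sqrt_le_iff.2 ⟨by positivity, ?_⟩
  calc Real.exp ((groupSize q δ * epsPrime q δ) ^ 2) ^ q * (q * (1 - 9 / 10) ^ groupSize q δ)
      ≤ (128 / 125) ^ groupSize q δ * (q ^ 2 * (1 - 9 / 10) ^ groupSize q δ) := by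
        have : (0 : ℝ) ≤ 1 - 9 / 10 := by norm_num
        gcongr
        · exact exp_sq_groupSize_mul_epsPrime_le hq hδ hδ1
        · exact le_self_pow₀ hq' two_ne_zero
    _ = (q * (8 / 25) ^ groupSize q δ) ^ 2 := by
        rw [mul_left_comm, ← mul_pow, mul_pow (q : ℝ), pow_right_comm]
        norm_num

theorem choose_div_choose_mul_sqrt_le (hq : 1 ≤ q) (hδ : 0 < δ) (hδ1 : δ < 1) {k b : ℕ}
    (hk : 20 * groupSize q δ ≤ k) (hb : 9 * k ≤ 20 * b) :
    k.choose (groupSize q δ) / b.choose (groupSize q δ) *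
      √(Real.exp ((groupSize q δ * epsPrime q δ) ^ 2) ^ q *
        (q * (1 - 9 / 10) ^ groupSize q δ)) ≤ δ / 2 := by
  have h_choose : (k.choose (groupSize q δ) / b.choose (groupSize q δ) : ℝ) ≤
      (5 / 2) ^ groupSize q δ :=
    div_le_of_le_mul₀ (Nat.cast_nonneg _) (by positivity) (choose_le_pow_mul_choose hk hb)
  refine (mul_le_mul h_choose (sqrt_exp_pow_mul_le hq hδ hδ1) (Real.sqrt_nonneg _)
    (by positivity)).trans (le_trans (le_of_eq ?_) (mul_pow_groupSize_le hq hδ))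
  rw [mul_left_comm, ← mul_pow]
  norm_num

end FailureProbability

section BoundedQueryAlgorithm

variable {q : ℕ} {α δ τ c C : ℝ}

theorem exists_isDPMedian_grid (hc : 2 ≤ c) (hq : 1 ≤ q) (hδ : 0 < δ) (hδ1 : δ < 1) (k : ℕ) :
    ∃ M : (Fin k → grid α τ) → PMF (grid α τ),
      IsDPMedian M (epsPrime q δ) (δ / (2 * q)) (medianError c q α δ τ) := by
  have : (0 : ℝ) < q := Nat.cast_pos.2 hq
  have h_inv_eps : 0 < (epsPrime q δ)⁻¹ := by linarith [hundred_le_inv_epsPrime hq hδ hδ1]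
  have : Nonempty (grid α τ) := ⟨⟨0, zero_mem_grid α τ⟩⟩
  refine ⟨_, isDPMedian_expMechanism_medianScore (inv_pos.1 h_inv_eps) (by positivity) ?_⟩
  rw [medianError, Fintype.card_coe]
  have h_log := log_card_grid_div_nonneg (α := α) (τ := τ) hq hδ hδ1
  gcongr

theorem medianError_add_one_le (hc : 0 ≤ c) (hC : 180 * c + 6 ≤ C) (hq : 1 ≤ q) (hα : 0 < α)
    (hα1 : α < 1) (hδ : 0 < δ) (hδ1 : δ < 1) (hτ : 1 ≤ τ) :
    medianError c q α δ τ + 1 ≤ numCopies C q α δ τ / 20 := by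
  have h_eps := hundred_le_inv_epsPrime hq hδ hδ1
  have h_log := (log_two_le_log_div hq hδ hδ1).trans (log_div_le_four_mul_log hq hα hα1 hδ hδ1 hτ)
  have h_log_two := Real.log_two_gt_d9
  have h_grid := log_card_grid_div_le hq hα hα1 hδ hδ1 hτ
  rw [medianError]
  set e := (epsPrime q δ)⁻¹
  set L := Real.log (2 * q * Real.log (2 * τ) / (α * δ))
  calc c * e * Real.log ((grid α τ).card / (δ / (2 * q))) + 1
      ≤ c * e * (9 * L) + 3 / 10 * (100 * L) := by
        gcongr
        linarith
    _ ≤ c * e * (9 * L) + 3 / 10 * (e * L) := by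
        gcongr
        linarith
    _ = (180 * c + 6) * e * L / 20 := by ring
    _ ≤ C * e * L / 20 := by
        gcongr
        linarith
    _ ≤ numCopies C q α δ τ / 20 := by
        gcongr
        exact Nat.le_ceil _

theorem mul_groupSize_le_numCopies (hC : 6 ≤ C) (hq : 1 ≤ q) (hα : 0 < α) (hα1 : α < 1)
    (hδ : 0 < δ) (hδ1 : δ < 1) (hτ : 1 ≤ τ) :
    20 * groupSize q δ ≤ numCopies C q α δ τ := by
  have h_log := log_div_le_four_mul_log hq hα hα1 hδ hδ1 hτ
  have h_log_nonneg := (Real.log_nonneg one_le_two).trans (log_two_le_log_div hq hδ hδ1)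
  have h_cast : (20 * groupSize q δ : ℝ) ≤ numCopies C q α δ τ := by
    calc (20 * groupSize q δ : ℝ)
        ≤ 6 * 100 * Real.log (2 * q * Real.log (2 * τ) / (α * δ)) := by
          linarith [groupSize_le hq hδ hδ1]
      _ ≤ C * (epsPrime q δ)⁻¹ * Real.log (2 * q * Real.log (2 * τ) / (α * δ)) := by
          gcongr
          · linarith
          · exact hundred_le_inv_epsPrime hq hδ hδ1
      _ ≤ numCopies C q α δ τ := Nat.le_ceil _
  exact_mod_cast h_cast

theorem numCopies_le (hC : 0 ≤ C) (hq : 1 ≤ q) (hα : 0 < α) (hα1 : α < 1) (hδ : 0 < δ)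
    (hδ1 : δ < 1) (hτ : 1 ≤ τ) :
    (numCopies C q α δ τ : ℝ) ≤ (900 * C + 10) *
      (√(q * Real.log (2 * q / δ)) * Real.log (2 * q * Real.log (2 * τ) / (α * δ))) := by
  have : (1 : ℝ) ≤ q := by exact_mod_cast hq
  have h_log_two := Real.log_two_gt_d9
  have h_log := log_two_le_log_div hq hδ hδ1
  have h_log_le := log_div_le_four_mul_log hq hα hα1 hδ hδ1 hτ
  have h_eps := hundred_le_inv_epsPrime hq hδ hδ1
  have h_eps_le := inv_epsPrime_le hq hδ hδ1
  have h_sqrt : 4 / 5 ≤ √(q * Real.log (2 * q / δ)) := Real.le_sqrt_of_sq_le (by nlinarith)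
  set R := √(q * Real.log (2 * q / δ))
  set L := Real.log (2 * q * Real.log (2 * τ) / (α * δ))
  calc (numCopies C q α δ τ : ℝ) ≤ C * (epsPrime q δ)⁻¹ * L + 1 :=
        (Nat.ceil_lt_add_one (mul_nonneg (mul_nonneg hC (by linarith)) (by linarith))).le
    _ ≤ C * (900 * R) * L + 10 * (4 / 5 * L) := by
        gcongr
        · linarith
        · linarith
    _ ≤ C * (900 * R) * L + 10 * (R * L) := by
        gcongr
        linarith
    _ = (900 * C + 10) * (R * L) := by ring

variable {n : ℕ} {A : StreamAlg n}

theorem isRobust_boundedQueryAlg_of_groupSize_le {f : (Fin n → ℤ) → ℝ} {m k : ℕ} {Γ : ℝ}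
    (hq : 1 ≤ q) (hα : 0 < α) (hα1 : α < 1) (hδ : 0 < δ) (hδ1 : δ < 1)
    (hf : ∀ us : List (Update n), us ≠ [] → us.length ≤ m →
      f (freq us) = 0 ∨ (1 ≤ f (freq us) ∧ f (freq us) ≤ τ))
    (hA : A.IsOblivious f (α / 3) m (9 / 10)) {M : (Fin k → grid α τ) → PMF (grid α τ)}
    (hM : IsDPMedian M (epsPrime q δ) (δ / (2 * q)) Γ) (hk : 20 * groupSize q δ ≤ k)
    (hΓ : Γ + 1 ≤ k / 20) : (boundedQueryAlg A α τ k M).IsRobust f α m q (1 - δ) := by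
  have : (0 : ℝ) < q := Nat.cast_pos.2 hq
  have h_bad : ((9 * k / 20 + 1 : ℕ) : ℝ) ≤ k / 2 - Γ := by
    have h_div : ((9 * k / 20 : ℕ) : ℝ) ≤ ((9 * k : ℕ) : ℝ) / ((20 : ℕ) : ℝ) := Nat.cast_div_le
    push_cast at h_div ⊢
    linarith
  have h_group := choose_div_choose_mul_sqrt_le hq hδ hδ1 hk
    (show 9 * k ≤ 20 * (9 * k / 20 + 1) by omega)
  have h_median : q * (δ / (2 * q)) = δ / 2 := by field_simp
  intro adv hadv
  exact le_trans (by linarith) (isRobust_boundedQueryAlg hα hα1 hf hA (by norm_num) hM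
    (s := groupSize q δ) (by omega) h_bad adv hadv)

namespace StreamAlg.UsesSpace

variable {w : ℕ} {S : ℝ}

theorem one_le_two_rpow (hA : A.UsesSpace w S) : (1 : ℝ) ≤ 2 ^ ((w : ℝ) * S) := by
  have : Finite A.State := hA.1
  have : Nonempty A.State := A.init.support_nonempty.to_subtype.map Subtype.val
  exact le_trans (by exact_mod_cast Nat.card_pos) hA.2

theorem boundedQueryAlg (hA : A.UsesSpace w S) {k : ℕ} {x : ℝ} (hx : k ≤ x)
    (M : (Fin k → grid α τ) → PMF (grid α τ)) :
    (boundedQueryAlg A α τ k M).UsesSpace w (x * S) := by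
  have : Finite A.State := hA.1
  refine ⟨inferInstanceAs (Finite (Fin k → A.State)), ?_⟩
  calc (Nat.card (Fin k → A.State) : ℝ) = (Nat.card A.State : ℝ) ^ k := by
        rw [Nat.card_fun, Nat.card_fin, Nat.cast_pow]
    _ ≤ ((2 : ℝ) ^ ((w : ℝ) * S)) ^ k := by gcongr; exact hA.2
    _ ≤ ((2 : ℝ) ^ ((w : ℝ) * S)) ^ x := by
        rw [← Real.rpow_natCast]
        exact Real.rpow_le_rpow_of_exponent_le hA.one_le_two_rpow hx
    _ = 2 ^ ((w : ℝ) * (x * S)) := by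
        rw [← Real.rpow_mul zero_le_two]
        ring_nf

end StreamAlg.UsesSpace

end BoundedQueryAlgorithm

end RobustStreaming

end

theorem mainTheorem2 :
    ∃ c₀ : ℝ, 0 < c₀ ∧ ∀ c : ℝ, c₀ ≤ c →
    ∃ C₀ : ℝ, 0 < C₀ ∧ ∀ C : ℝ, C₀ ≤ C →
    ∃ K : ℝ, 0 < K ∧
    ∀ (n m q w : ℕ) (α δ τ S : ℝ) (f : (Fin n → ℤ) → ℝ) (A : StreamAlg n),
      1 ≤ q → 0 < α → α < 1 → 0 < δ → δ < 1 → 1 ≤ τ →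
      (∀ us : List (Update n), us ≠ [] → us.length ≤ m →
        f (freq us) = 0 ∨ (1 ≤ f (freq us) ∧ f (freq us) ≤ τ)) →
      A.IsOblivious f (α / 3) m (9 / 10) →
      A.UsesSpace w S →
      (∃ M : (Fin (numCopies C q α δ τ) → grid α τ) → PMF (grid α τ),
        IsDPMedian M (epsPrime q δ) (δ / (2 * q)) (medianError c q α δ τ)) ∧
      ∀ M : (Fin (numCopies C q α δ τ) → grid α τ) → PMF (grid α τ),
        IsDPMedian M (epsPrime q δ) (δ / (2 * q)) (medianError c q α δ τ) →
        (boundedQueryAlg A α τ (numCopies C q α δ τ) M).IsRobust f α m q (1 - δ) ∧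
        (boundedQueryAlg A α τ (numCopies C q α δ τ) M).UsesSpace w
          (K * (Real.sqrt (q * Real.log (2 * q / δ)) *
            Real.log (2 * q * Real.log (2 * τ) / (α * δ))) * S) := by
  refine ⟨2, two_pos, fun c hc => ⟨180 * c + 6, by linarith, fun C hC =>
    ⟨900 * C + 10, by linarith, fun n m q w α δ τ S f A hq hα hα1 hδ hδ1 hτ hf hA hS =>
      ⟨exists_isDPMedian_grid hc hq hδ hδ1 _, fun M hM => ⟨?robust, ?space⟩⟩⟩⟩⟩
  case robust =>
    exact isRobust_boundedQueryAlg_of_groupSize_le hq hα hα1 hδ hδ1 hf hA hM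
      (mul_groupSize_le_numCopies (by linarith) hq hα hα1 hδ hδ1 hτ)
      (medianError_add_one_le (by linarith) hC hq hα hα1 hδ hδ1 hτ)
  case space =>
    exact hS.boundedQueryAlg (numCopies_le (by linarith) hq hα hα1 hδ hδ1 hτ) M
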